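/- Let $n\ge 1$. Let $\hat f(\xi)=\int_{\mathbf R^n} f(x)e^{-2\pi i x\cdot\xi}\,dx$ be the Fourier transform. Fix a smooth, even, nonnegative function $\chi$ on $\mathbf R^n$ with $\chi(\xi)=1$ for $|\xi|\le 1$ and $\chi(\xi)=0$ for $|\xi|>2$. Put $\varphi(\xi)=\chi(\xi)-\chi(2\xi)$. For $l\in\mathbf Z$ let $P_l$ be the Littlewood–Paley operator $$P_l g(\xi)=2^{ln}\int_{\mathbf R^n}\hat\varphi(2^l(\xi-\eta))\,g(\eta)\,d\eta .$$ For $2<p<\infty$ and $s\ge 0$ let $$\|g\|_{W^{p,s}}=\|g\|_{L^p}+\Big\|\Big(\sum_{l=0}^\infty 2^{2ls}|P_l g|^2\Big)^{1/2}\Big\|_{L^p}.$$ A *symbol* is a measurable function $\sigma:\mathbf R^n\times\mathbf R^n\to\mathbf C$ such that, for every $x$, the function $\sigma(x,\cdot)$ is locally integrable and vanishes at infinity in the mean: $$\lim_{R\to\infty}\frac1{|B(0,R)|}\int_{B(0,R)}|\sigma(x,\xi)|\,d\xi=0 .$$ (This is the normalization that belongs to a homogeneous norm in $\xi$: every $P_l$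 annihilates polynomials in $\xi$.) For Schwartz functions $f$ let $$T_\sigma f(x)=\int_{\mathbf R^n}\sigma(x,\xi)\,e^{2\pi i\xi\cdot x}\hat f(\xi)\,d\xi ,$$ and let $\|T_\sigma\|_{L^2\to L^2}\in[0,\infty]$ be the supremum of $\|T_\sigma f\|_{L^2}/\|f\|_{L^2}$ over all Schwartz functions $f\ne 0$. **Theorem.** (i) There is a constant $C>0$, depending only on $n$ and $\chi$, such that for every symbol $\sigma$ $$\|T_\sigma\|_{L^2(\mathbf R^n)\to L^2(\mathbf R^n)}\le C\sum_{l\in\mathbf Z}2^{ln/2}\sup_{x}\|P_l^\xi\sigma(x,\cdot)\|_{L^2(\mathbf R^n)},$$ where $P_l^\xi$ is $P_l$ acting in the variable $\xi$. If the right-hand side is finite, $T_\sigma$ extends to a bounded linear operator on $L^2(\mathbf R^n)$. (ii) The result is sharp in the following sense. For every real $p>2$ there is a symbol $\sigma$ such that $\sigma(x,\cdot)$ is smooth on $\mathbf R^n\setminus\{0\}$ for every $x$, such that for every multi-index $\alpha$ there is a constant $C_\alpha$ with $$\sup_x|D_\xi^\alpha\sigma(x,\xi)|\le C_\alpha|\xi|^{-|\alpha|}\qquad(\xi\neq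 0),$$ and such that $\sup_x\|\sigma(x,\cdot)\|_{W^{p,n/p}}<\infty$, but $\|T_\sigma\|_{L^2\to L^2}=\infty$, i.e. $T_\sigma$ is not bounded on $L^2(\mathbf R^n)$. -/

import Mathlib

open MeasureTheory Filter Topology
open scoped ENNReal FourierTransform SchwartzMap ContDiff

noncomputable section

namespace RoughPDO

/-- The Euclidean space `ℝⁿ`. -/
abbrev E (n : ℕ) : Type := EuclideanSpace ℝ (Fin n)

/-- A smooth, even, nonnegative cutoff that equals `1` on the unit ball and is supported in the
ball of radius `2`. -/
structure IsCutoff {n : ℕ} (χ : E n → ℝ) : Prop where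
  smooth : ContDiff ℝ ∞ χ
  even : ∀ ξ, χ (-ξ) = χ ξ
  nonneg : ∀ ξ, 0 ≤ χ ξ
  eq_one : ∀ ξ, ‖ξ‖ ≤ 1 → χ ξ = 1
  eq_zero : ∀ ξ, 2 < ‖ξ‖ → χ ξ = 0

/-- The Littlewood-Paley annular function `φ(ξ) = χ(ξ) - χ(2ξ)`. -/
def annular {n : ℕ} (χ : E n → ℝ) (ξ : E n) : ℂ :=
  ((χ ξ - χ ((2 : ℝ) • ξ) : ℝ) : ℂ)

/-- The Littlewood-Paley operator
`P_l f(ξ) = 2^{ln} ∫ φ̂(2^l (ξ - η)) f(η) dη`, `l ∈ ℤ`. -/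
def lpProj {n : ℕ} (χ : E n → ℝ) (l : ℤ) (f : E n → ℂ) (ξ : E n) : ℂ :=
  ((2 : ℂ) ^ (l * (n : ℤ))) *
    ∫ η : E n, 𝓕 (annular χ) (((2 : ℝ) ^ l) • (ξ - η)) * f η

/-- The symbols `σ : ℝⁿ × ℝⁿ → ℂ`: measurable functions such that, for every `x`, the function
`σ(x, ·)` is locally integrable and vanishes at infinity in the mean. All `P_l` annihilate
polynomials in `ξ`, and the last condition says that `σ(x, ·)` has no polynomial part. -/
structure IsSymbol {n : ℕ} (σ : E n → E n → ℂ) : Prop where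
  measurable : AEStronglyMeasurable (fun z : E n × E n => σ z.1 z.2) volume
  locallyIntegrable : ∀ x, LocallyIntegrable (σ x) volume
  mean_tendsto_zero : ∀ x,
    Tendsto (fun R : ℝ => ⨍ ξ in Metric.ball (0 : E n) R, ‖σ x ξ‖) atTop (𝓝 0)

/-- The pseudodifferential operator
`T_σ f(x) = ∫ σ(x, ξ) e^{2π i ξ·x} f̂(ξ) dξ`. -/
def pdo {n : ℕ} (σ : E n → E n → ℂ) (f : E n → ℂ) (x : E n) : ℂ :=
  ∫ ξ : E n, σ x ξ *
    Complex.exp (2 * (Real.pi : ℂ) * Complex.I * ((inner ℝ ξ x : ℝ) : ℂ)) * 𝓕 f ξ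

/-- The `L² → L²` norm of `T_σ`, taken over the (dense) class of Schwartz functions. -/
def pdoNorm {n : ℕ} (σ : E n → E n → ℂ) : ℝ≥0∞ :=
  ⨆ f : 𝓢(E n, ℂ), eLpNorm (pdo σ f) 2 volume / eLpNorm f 2 volume

/-- The quantity `∑_{l ∈ ℤ} 2^{ln/2} sup_x ‖P_l^ξ σ(x, ·)‖_{L²}`. -/
def besovSup {n : ℕ} (χ : E n → ℝ) (σ : E n → E n → ℂ) : ℝ≥0∞ :=
  ∑' l : ℤ, (2 : ℝ≥0∞) ^ ((l : ℝ) * (n : ℝ) / 2) *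
    ⨆ x : E n, eLpNorm (lpProj χ l (σ x)) 2 volume

/-- The (inhomogeneous) Sobolev norm
`‖f‖_{W^{p,s}} = ‖f‖_{L^p} + ‖(∑_{l ≥ 0} 2^{2ls} |P_l f|²)^{1/2}‖_{L^p}`. -/
def sobolevNorm {n : ℕ} (χ : E n → ℝ) (p s : ℝ) (f : E n → ℂ) : ℝ≥0∞ :=
  eLpNorm f (ENNReal.ofReal p) volume +
    eLpNorm
      (fun ξ : E n =>
        (∑' l : ℕ, (2 : ℝ≥0∞) ^ (2 * (l : ℝ) * s) * ‖lpProj χ (l : ℤ) f ξ‖ₑ ^ 2) ^ (1 / 2 : ℝ))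
      (ENNReal.ofReal p) volume

/-- The bounds `sup_x |D_ξ^α σ(x, ξ)| ≤ C_α |ξ|^{-|α|}`, `ξ ≠ 0`, of all orders. -/
def MihlinBounds {n : ℕ} (σ : E n → E n → ℂ) : Prop :=
  (∀ x, ContDiffOn ℝ ∞ (σ x) {0}ᶜ) ∧
    ∀ k : ℕ, ∃ C : ℝ, ∀ x ξ : E n, ξ ≠ 0 →
      ‖iteratedFDeriv ℝ k (σ x) ξ‖ ≤ C / ‖ξ‖ ^ k

end RoughPDO

end

noncomputable section

namespace RoughPDO

/-! Part (i). Modulating the Fourier transform of `f` amounts to translating `f`, so `T_σ f(x)` is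
the pairing of `g = σ(x, ·)` with the Fourier transform of `h = f(· + x)` (`pdo_eq`). Cutting `h`
with the dyadic pieces of `χ` gives a telescoping sum. The top end converges to the full pairing;
the bottom end is an average of `g` over balls of radius about `2^N` and dies because `g` vanishes
at infinity in the mean. This replaces a Littlewood-Paley decomposition of `g` itself, whose
convergence never has to be discussed (`MeanZero.enorm_integral_mul_fourier_le`).

In the piece of index `l` the cutoff `φ(2^{-l}·)` can be moved onto `g`, producing `P_l g`, while a
wider cutoff `χ(2^{-l-1}·)` stays on `h`. Cauchy-Schwarz and Plancherel bound the piece by `‖P_l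
σ(x, ·)‖₂` times the `L²` norm of `f(· + x) χ(2^{-l-1}·)`. By Fubini the square of the latter
integrates in `x` to a constant times `2^{ln} ‖f‖₂²`, and Minkowski's inequality sums over `l`
(`eLpNorm_pdo_le`).

Part (ii). One symbol serves every `p > 2`: `∑ₖ (k+1)^{-1/2} e^{-2πi 2^{-k} e·x} ψ(2ᵏξ)`, with `ψ` a
bump near a unit vector `e`. The terms have disjoint supports, which gives the Mihlin bounds. On the
shell `|ξ| ~ 2^{-m}` the square function of order `n/p` is of size at most `(m+1)^{-1/2} 2^{mn/p}`;
the shell has volume about `2^{-mn}`, so the `p`-th power of the norm is controlled by `∑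
(m+1)^{-p/2}`, finite exactly because `p > 2`.

For unboundedness, take `f̂ = ∑_{k<N} (k+1)^{-1/2} G(ξ - 2^{-k}e)` with `G` concentrated near `0`.
The phases of the symbol undo the modulations, so all terms add up to the same function: `T_σ f = H
𝓕⁻G` with `H = ∑_{k<N} 1/(k+1)`. The pieces of `f̂` are disjoint, so `‖f‖₂ = √H ‖G‖₂`, and the
quotient `√H` diverges with the harmonic series. -/

/-! ### Fourier calculus of dilates and products of Schwartz functions. -/

/-- The dyadic dilate `y ↦ a (2 ^ l y)` of a Schwartz function. -/
def dil {n : ℕ} (l : ℤ) (a : 𝓢(E n, ℂ)) : 𝓢(E n, ℂ) :=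
  SchwartzMap.compCLMOfContinuousLinearEquiv ℂ
    (ContinuousLinearEquiv.smulLeft (Units.mk0 ((2 : ℝ) ^ l) (by positivity))) a

@[simp] lemma dil_apply {n : ℕ} (l : ℤ) (a : 𝓢(E n, ℂ)) (y : E n) :
    dil l a y = a (((2 : ℝ) ^ l) • y) := rfl

/-- The pointwise product of Schwartz functions. -/
def mulS {n : ℕ} (a b : 𝓢(E n, ℂ)) : 𝓢(E n, ℂ) :=
  SchwartzMap.pairing (ContinuousLinearMap.mul ℂ ℂ) a b

@[simp] lemma mulS_apply {n : ℕ} (a b : 𝓢(E n, ℂ)) (y : E n) : mulS a b y = a y * b y := rfl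

lemma IsCutoff.hasCompactSupport {n : ℕ} {χ : E n → ℝ} (hχ : IsCutoff χ) :
    HasCompactSupport (fun ξ => (χ ξ : ℂ)) := by
  refine HasCompactSupport.intro (isCompact_closedBall (0 : E n) 2) fun x hx => ?_
  rw [hχ.eq_zero x (by simpa using hx), Complex.ofReal_zero]

/-- The cutoff as a Schwartz function. -/
def cutS {n : ℕ} {χ : E n → ℝ} (hχ : IsCutoff χ) : 𝓢(E n, ℂ) :=
  hχ.hasCompactSupport.toSchwartzMap (Complex.ofRealCLM.contDiff.comp hχ.smooth)

@[simp] lemma cutS_apply {n : ℕ} {χ : E n → ℝ} (hχ : IsCutoff χ) (y : E n) :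
    cutS hχ y = (χ y : ℂ) := rfl

/-- The annular function as a Schwartz function. -/
def annS {n : ℕ} {χ : E n → ℝ} (hχ : IsCutoff χ) : 𝓢(E n, ℂ) := cutS hχ - dil 1 (cutS hχ)

lemma annS_apply {n : ℕ} {χ : E n → ℝ} (hχ : IsCutoff χ) (y : E n) :
    annS hχ y = annular χ y := by
  simp [annS, annular]

lemma annS_coe {n : ℕ} {χ : E n → ℝ} (hχ : IsCutoff χ) :
    (annS hχ : E n → ℂ) = annular χ := funext (annS_apply hχ)

lemma annular_eq_zero_of_lt {n : ℕ} {χ : E n → ℝ} (hχ : IsCutoff χ) {y : E n} (hy : ‖y‖ < 1 / 2) :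
    annular χ y = 0 := by
  rw [annular, hχ.eq_one _ (by linarith), hχ.eq_one _ (by rw [norm_smul]; norm_num; linarith)]
  simp

lemma annular_eq_zero_of_gt {n : ℕ} {χ : E n → ℝ} (hχ : IsCutoff χ) {y : E n} (hy : 2 < ‖y‖) :
    annular χ y = 0 := by
  rw [annular, hχ.eq_zero _ hy, hχ.eq_zero _ (by rw [norm_smul]; norm_num; linarith)]
  simp

lemma fourier_apply {n : ℕ} (f : E n → ℂ) (ξ : E n) :
    𝓕 f ξ = ∫ x : E n, Complex.exp (-(2 * (Real.pi : ℂ) * Complex.I *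
      ((inner ℝ x ξ : ℝ) : ℂ))) * f x := by
  rw [Real.fourier_eq']
  refine integral_congr_ae (ae_of_all _ fun x => ?_)
  simp only [smul_eq_mul]
  congr 2
  push_cast
  ring

lemma fourier_comp_smul {n : ℕ} (f : E n → ℂ) {t : ℝ} (ht : 0 < t) (ξ : E n) :
    𝓕 (fun y => f (t • y)) ξ = ((t ^ n)⁻¹ : ℝ) * 𝓕 f (t⁻¹ • ξ) := by
  have := Measure.integral_comp_smul_of_nonneg (volume : Measure (E n)) (fun x : E n =>
    Complex.exp (-(2 * (Real.pi : ℂ) * Complex.I * ((inner ℝ x (t⁻¹ • ξ) : ℝ) : ℂ))) * f x)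
    t (hR := ht.le)
  rw [fourier_apply, fourier_apply]
  simp only [finrank_euclideanSpace, Fintype.card_fin, real_inner_smul_left, real_inner_smul_right,
    ← mul_assoc, inv_mul_cancel₀ ht.ne', one_mul, Complex.real_smul] at this ⊢
  exact this

lemma fourier_dil {n : ℕ} (l : ℤ) (a : 𝓢(E n, ℂ)) (ξ : E n) :
    𝓕 (dil l a) ξ = (2 : ℂ) ^ (-l * (n : ℤ)) * 𝓕 a (((2 : ℝ) ^ (-l)) • ξ) := by
  have := fourier_comp_smul (a : E n → ℂ) (t := (2 : ℝ) ^ l) (by positivity) ξ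
  rw [SchwartzMap.fourier_coe, SchwartzMap.fourier_coe]
  refine Eq.trans this ?_
  rw [zpow_neg]
  congr 1
  push_cast
  rw [neg_mul, zpow_neg, zpow_mul, zpow_natCast]

lemma fourier_neg {n : ℕ} {a : 𝓢(E n, ℂ)} (ha : ∀ x, a (-x) = a x) (ξ : E n) :
    𝓕 a (-ξ) = 𝓕 a ξ := by
  rw [SchwartzMap.fourier_coe, fourier_apply, fourier_apply,
    ← integral_neg_eq_self (μ := (volume : Measure (E n)))]
  simp [ha]

lemma fourier_fourier_apply {n : ℕ} (a : 𝓢(E n, ℂ)) (x : E n) : 𝓕 (𝓕 a) x = a (-x) := by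
  have h : 𝓕⁻ (𝓕 a) (-x) = a (-x) := by simp
  rw [← h, SchwartzMap.fourierInv_coe, Real.fourierInv_eq_fourier_neg, neg_neg]
  rfl

/-- After one more Fourier transform both sides become the product `a(-x) b(-x)`, and Fourier
inversion removes that extra transform. -/
lemma integral_fourier_sub_mul_fourier {n : ℕ} (a b : 𝓢(E n, ℂ)) (ξ : E n) :
    ∫ η, 𝓕 a (ξ - η) * 𝓕 b η = 𝓕 (mulS a b) ξ := by
  have h : SchwartzMap.convolution (ContinuousLinearMap.mul ℂ ℂ) (𝓕 b) (𝓕 a) = 𝓕 (mulS a b) := by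
    have h1 : 𝓕 (SchwartzMap.convolution (ContinuousLinearMap.mul ℂ ℂ) (𝓕 b) (𝓕 a))
        = 𝓕 (𝓕 (mulS a b)) := by
      ext x
      rw [SchwartzMap.fourier_convolution, fourier_fourier_apply, SchwartzMap.pairing_apply_apply,
        fourier_fourier_apply, fourier_fourier_apply]
      simp [mul_comm]
    simpa using congrArg (fun u : 𝓢(E n, ℂ) => 𝓕⁻ u) h1
  rw [← h, SchwartzMap.convolution_apply]
  simp only [MeasureTheory.convolution, ContinuousLinearMap.mul_apply']
  exact integral_congr_ae (ae_of_all _ fun x => mul_comm _ _)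

/-- `P_l` acts on Fourier transforms as a multiplication by `φ(2^{-l} ·)`. -/
lemma lpProj_fourier {n : ℕ} {χ : E n → ℝ} (hχ : IsCutoff χ) (l : ℤ) (h : 𝓢(E n, ℂ)) (ξ : E n) :
    lpProj χ l (𝓕 h : 𝓢(E n, ℂ)) ξ = 𝓕 (mulS h (dil (-l) (annS hχ))) ξ := by
  have hc : mulS h (dil (-l) (annS hχ)) = mulS (dil (-l) (annS hχ)) h := by
    ext y; exact mul_comm _ _
  rw [hc, ← integral_fourier_sub_mul_fourier, lpProj, ← integral_const_mul]
  refine integral_congr_ae (ae_of_all _ fun η => ?_)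
  simp only [fourier_dil, neg_neg, ← annS_coe hχ, mul_assoc]
  rfl

/-! ### Uniform decay of Fourier transforms of products. -/

/-- Leibniz's rule. The derivatives of `f` vanish off its closed support, so bounds on `u` are
needed only there; this is what later allows `u` to be singular, after rescaling, near a point that
`f` avoids. -/
lemma integral_iteratedFDeriv_mulS_le {n : ℕ} (f u : 𝓢(E n, ℂ)) {K i : ℕ} (hi : i ≤ K) {A : ℝ}
    (hA : ∀ j ≤ K, ∀ y ∈ tsupport f, ‖iteratedFDeriv ℝ j u y‖ ≤ A) :
    ∫ v, ‖iteratedFDeriv ℝ i (mulS f u) v‖ ≤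
      (∑ j ∈ Finset.range (i + 1), (i.choose j : ℝ) * ∫ v, ‖iteratedFDeriv ℝ j f v‖) * A := by
  have hint (j : ℕ) (w : 𝓢(E n, ℂ)) : Integrable (fun v => ‖iteratedFDeriv ℝ j w v‖) := by
    simpa using w.integrable_pow_mul_iteratedFDeriv volume 0 j
  have key (v : E n) : ‖iteratedFDeriv ℝ i (mulS f u) v‖ ≤
      ∑ j ∈ Finset.range (i + 1), (i.choose j : ℝ) * ‖iteratedFDeriv ℝ j f v‖ * A := by
    refine (norm_iteratedFDeriv_mul_le (f.smooth ⊤) (u.smooth ⊤) v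
      (n := i) (mod_cast le_top)).trans (Finset.sum_le_sum fun j hj => ?_)
    by_cases hv : v ∈ tsupport f
    · gcongr
      exact hA _ (by omega) v hv
    · have : iteratedFDeriv ℝ j f v = 0 := by
        by_contra h
        exact hv (support_iteratedFDeriv_subset (𝕜 := ℝ) j h)
      simp [this]
  calc _ ≤ ∫ v, ∑ j ∈ Finset.range (i + 1), (i.choose j : ℝ) * ‖iteratedFDeriv ℝ j f v‖ * A :=
        integral_mono (hint i _) (integrable_finsetSum _ fun j _ =>
          ((hint j f).const_mul _).mul_const _) key
    _ = _ := by
        rw [integral_finsetSum _ fun j _ => ((hint j f).const_mul _).mul_const _, Finset.sum_mul]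
        simp_rw [integral_mul_const, integral_const_mul]

/-- Decay of the Fourier transform of a product, in terms of the derivatives of one factor on the
support of the other one. -/
lemma exists_fourier_mulS_decay {n : ℕ} (f : 𝓢(E n, ℂ)) (K : ℕ) : ∃ C : ℝ, 0 ≤ C ∧
    ∀ (u : 𝓢(E n, ℂ)) (A : ℝ), (∀ j ≤ K, ∀ y ∈ tsupport f, ‖iteratedFDeriv ℝ j u y‖ ≤ A) →
      ∀ ζ, (1 + ‖ζ‖) ^ K * ‖𝓕 (mulS f u) ζ‖ ≤ C * A := by
  set B : ℕ → ℝ := fun i =>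
    ∑ j ∈ Finset.range (i + 1), (i.choose j : ℝ) * ∫ v, ‖iteratedFDeriv ℝ j f v‖ with hB
  have hB0 (i : ℕ) : 0 ≤ B i := by
    refine Finset.sum_nonneg fun j _ => mul_nonneg (by positivity) ?_
    exact integral_nonneg fun _ => norm_nonneg _
  refine ⟨2 ^ (K - 1) * (B 0 + 2 ^ K * ∑ i ∈ Finset.range (K + 1), B i), ?_, ?_⟩
  · have := Finset.sum_nonneg (s := Finset.range (K + 1)) fun i _ => hB0 i
    have := hB0 0
    positivity
  intro u A hA ζ
  have hm (m : ℕ) (hmK : m ≤ K) : ‖ζ‖ ^ m * ‖𝓕 (mulS f u) ζ‖ ≤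
      2 ^ m * ∑ i ∈ Finset.range (m + 1), B i * A := by
    have h1 := Real.pow_mul_norm_iteratedFDeriv_fourier_le (V := E n) (f := mulS f u)
      (K := 0) (N := ⊤) ((mulS f u).smooth ⊤)
      (fun k i _ _ => (mulS f u).integrable_pow_mul_iteratedFDeriv volume k i)
      (k := 0) (n := m) le_rfl (by exact_mod_cast le_top) ζ
    simp only [norm_iteratedFDeriv_zero, pow_zero, one_mul, zero_add, Finset.range_one,
      Finset.singleton_product, Finset.sum_map, Function.Embedding.coeFn_mk] at h1
    refine h1.trans ?_
    norm_num
    refine Finset.sum_le_sum fun i hi => ?_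
    exact integral_iteratedFDeriv_mulS_le f u
      (by have := Finset.mem_range.1 hi; omega) hA
  have h0 := hm 0 (Nat.zero_le _)
  have hK := hm K le_rfl
  simp only [pow_zero, one_mul, zero_add, Finset.range_one, Finset.sum_singleton] at h0
  -- Convexity, `(1 + |ζ|)^K ≤ 2^(K-1) (1 + |ζ|^K)`: only the exponents `0` and `K` of `hm` are
  -- used.
  have h2 := add_pow_le zero_le_one (norm_nonneg ζ) K
  rw [one_pow] at h2
  calc _ ≤ 2 ^ (K - 1) * (1 + ‖ζ‖ ^ K) * ‖𝓕 (mulS f u) ζ‖ := by gcongr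
    _ = 2 ^ (K - 1) * (‖𝓕 (mulS f u) ζ‖ + ‖ζ‖ ^ K * ‖𝓕 (mulS f u) ζ‖) := by ring
    _ ≤ 2 ^ (K - 1) * (B 0 * A + 2 ^ K * ∑ i ∈ Finset.range (K + 1), B i * A) := by gcongr
    _ = _ := by rw [← Finset.sum_mul]; ring

lemma norm_iteratedFDeriv_dil {n : ℕ} (l : ℤ) (h : 𝓢(E n, ℂ)) (i : ℕ) (y : E n) :
    ‖iteratedFDeriv ℝ i (dil l h) y‖ =
      ((2 : ℝ) ^ l) ^ i * ‖iteratedFDeriv ℝ i h (((2 : ℝ) ^ l) • y)‖ := by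
  have := iteratedFDeriv_comp_const_smul (𝕜 := ℝ) (f := h) (i := i) ((2 : ℝ) ^ l) (h.smooth i)
  have h2 : (dil l h : E n → ℂ) = fun z => h (((2 : ℝ) ^ l) • z) := rfl
  rw [h2, this, norm_smul, norm_pow, Real.norm_of_nonneg (by positivity)]

/-- Uniform decay when the second factor is stretched. -/
lemma exists_fourier_mulS_dil_decay {n : ℕ} (f h : 𝓢(E n, ℂ)) (K : ℕ) : ∃ C : ℝ, 0 ≤ C ∧
    ∀ l : ℤ, l ≤ 0 → ∀ ζ, (1 + ‖ζ‖) ^ K * ‖𝓕 (mulS f (dil l h)) ζ‖ ≤ C := by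
  obtain ⟨C, hC, H⟩ := exists_fourier_mulS_decay f K
  refine ⟨C * ∑ i ∈ Finset.range (K + 1), SchwartzMap.seminorm ℝ 0 i h,
    mul_nonneg hC (Finset.sum_nonneg fun i _ => apply_nonneg _ _), fun l hl => H _ _ ?_⟩
  intro j hj y _
  rw [norm_iteratedFDeriv_dil]
  calc _ ≤ 1 * SchwartzMap.seminorm ℝ 0 j h := by
        gcongr
        · exact pow_le_one₀ (by positivity) (zpow_le_one_of_nonpos₀ one_le_two hl)
        · exact h.norm_iteratedFDeriv_le_seminorm ℝ j _
    _ ≤ _ := by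
        rw [one_mul]
        exact Finset.single_le_sum (f := fun i => SchwartzMap.seminorm ℝ 0 i h)
          (fun i _ => apply_nonneg _ _) (Finset.mem_range.2 (by omega))

/-- Rapid decay when the second factor is contracted and the first one vanishes near the origin. -/
lemma exists_fourier_mulS_dil_decay_of_nonneg {n : ℕ} (f h : 𝓢(E n, ℂ)) (K M : ℕ)
    (hf : ∀ y, ‖y‖ < 1 / 2 → f y = 0) : ∃ C : ℝ, 0 ≤ C ∧
    ∀ l : ℕ, ∀ ζ, (1 + ‖ζ‖) ^ K * ‖𝓕 (mulS f (dil l h)) ζ‖ ≤ C * ((2 : ℝ) ^ (l * M))⁻¹ := by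
  obtain ⟨C, hC, H⟩ := exists_fourier_mulS_decay f K
  refine ⟨C * ∑ i ∈ Finset.range (K + 1), 2 ^ (i + M) * SchwartzMap.seminorm ℝ (i + M) i h,
    mul_nonneg hC (Finset.sum_nonneg fun i _ => mul_nonneg (by positivity) (apply_nonneg _ _)),
    fun l => ?_⟩
  simp_rw [mul_assoc C]
  refine H _ _ ?_
  intro j hj y hy
  have hy' : 1 / 2 ≤ ‖y‖ := by
    have : tsupport f ⊆ {y | 1 / 2 ≤ ‖y‖} := by
      refine closure_minimal (fun z hz => ?_) (isClosed_le continuous_const continuous_norm)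
      by_contra h'
      exact hz (hf z (not_le.1 h'))
    exact this hy
  rw [norm_iteratedFDeriv_dil]
  -- On the support of `f` one has `|2^l y| ≥ 2^l / 2`. The seminorm of weight `j + M` therefore
  -- pays for the chain-rule factor `2^{lj}` and leaves a gain of `2^{-lM}`.
  have h1 := h.le_seminorm ℝ (j + M) j (((2 : ℝ) ^ (l : ℤ)) • y)
  rw [norm_smul, Real.norm_of_nonneg (by positivity), zpow_natCast] at h1
  rw [zpow_natCast]
  have h3 : (2 : ℝ) ^ l ≤ 2 * (2 ^ l * ‖y‖) := by
    nlinarith [show (0 : ℝ) < 2 ^ l by positivity]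
  have h4 : ((2 : ℝ) ^ l) ^ (j + M) ≤ 2 ^ (j + M) * (2 ^ l * ‖y‖) ^ (j + M) := by
    rw [← mul_pow]; gcongr
  calc ((2 : ℝ) ^ l) ^ j * ‖iteratedFDeriv ℝ j h (((2 : ℝ) ^ l) • y)‖
      = (((2 : ℝ) ^ l) ^ (j + M) * ‖iteratedFDeriv ℝ j h (((2 : ℝ) ^ l) • y)‖)
        * ((2 : ℝ) ^ (l * M))⁻¹ := by
        rw [pow_add, pow_mul]; field_simp
    _ ≤ (2 ^ (j + M) * (2 ^ l * ‖y‖) ^ (j + M) *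
          ‖iteratedFDeriv ℝ j h (((2 : ℝ) ^ l) • y)‖) * ((2 : ℝ) ^ (l * M))⁻¹ := by gcongr
    _ ≤ (2 ^ (j + M) * SchwartzMap.seminorm ℝ (j + M) j h) * ((2 : ℝ) ^ (l * M))⁻¹ := by
        rw [mul_assoc (2 ^ (j + M) : ℝ)]; gcongr
    _ ≤ _ := by
        gcongr
        exact Finset.single_le_sum
          (f := fun i => 2 ^ (i + M) * SchwartzMap.seminorm ℝ (i + M) i h)
          (fun i _ => mul_nonneg (by positivity) (apply_nonneg _ _))
          (Finset.mem_range.2 (by omega))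

/-! ### Functions vanishing at infinity in the mean. -/

/-- Locally integrable functions whose means over large balls tend to zero. -/
structure MeanZero {n : ℕ} (g : E n → ℂ) : Prop where
  locallyIntegrable : LocallyIntegrable g volume
  tendsto : Tendsto (fun R : ℝ => ⨍ ξ in Metric.ball (0 : E n) R, ‖g ξ‖) atTop (𝓝 0)

lemma IsSymbol.meanZero {n : ℕ} {σ : E n → E n → ℂ} (hσ : IsSymbol σ) (x : E n) :
    MeanZero (σ x) := ⟨hσ.locallyIntegrable x, hσ.mean_tendsto_zero x⟩

lemma MeanZero.integrableOn_ball {n : ℕ} {g : E n → ℂ} (hg : MeanZero g) (R : ℝ) :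
    IntegrableOn g (Metric.ball 0 R) :=
  (hg.locallyIntegrable.integrableOn_isCompact (isCompact_closedBall 0 R)).mono_set
    Metric.ball_subset_closedBall

lemma volume_real_ball {n : ℕ} {R : ℝ} (hR : 0 < R) :
    (volume : Measure (E n)).real (Metric.ball 0 R) =
      R ^ n * (volume : Measure (E n)).real (Metric.ball 0 1) := by
  rw [measureReal_def, Measure.addHaar_ball_of_pos _ _ hR, ENNReal.toReal_mul,
    ENNReal.toReal_ofReal (by positivity), finrank_euclideanSpace, Fintype.card_fin]
  rfl

lemma volume_real_unit_ball_pos {n : ℕ} : 0 < (volume : Measure (E n)).real (Metric.ball 0 1) :=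
  ENNReal.toReal_pos (Metric.measure_ball_pos _ _ one_pos).ne' measure_ball_lt_top.ne

lemma MeanZero.lintegral_ball_le {n : ℕ} {g : E n → ℂ} (hg : MeanZero g) {ε : ℝ} (hε : 0 < ε) :
    ∀ᶠ R in atTop, ∫⁻ ξ in Metric.ball (0 : E n) R, ‖g ξ‖ₑ ≤ ENNReal.ofReal (ε * R ^ n) := by
  set V := (volume : Measure (E n)).real (Metric.ball 0 1) with hV
  have hVpos : 0 < V := volume_real_unit_ball_pos
  filter_upwards [hg.tendsto.eventually (gt_mem_nhds (show 0 < ε / V by positivity)),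
    eventually_gt_atTop 0] with R hR hR0
  have h1 : ∫ ξ in Metric.ball (0 : E n) R, ‖g ξ‖ ≤ ε * R ^ n := by
    rw [setAverage_eq, volume_real_ball hR0, ← hV, smul_eq_mul, inv_mul_lt_iff₀ (by positivity)] at hR
    refine hR.le.trans_eq ?_
    field_simp
  rw [← ofReal_integral_norm_eq_lintegral_enorm (hg.integrableOn_ball R)]
  exact ENNReal.ofReal_le_ofReal h1

/-- A single term suffices: the one for the least `m` with `|η| < 2^m r`. If `m > 0`, minimality
gives `2^m ≤ 2 (1 + |η|/r)`. -/
lemma inv_pow_le_tsum_indicator_ball {n : ℕ} (K : ℕ) {r : ℝ} (hr : 0 < r) (η : E n) :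
    ENNReal.ofReal (((1 + ‖η‖ / r) ^ K)⁻¹) ≤
      ∑' m : ℕ, (Metric.ball (0 : E n) (2 ^ m * r)).indicator
        (fun _ => ENNReal.ofReal (2 ^ K * ((2 : ℝ) ^ (m * K))⁻¹)) η := by
  have hex : ∃ m : ℕ, ‖η‖ < 2 ^ m * r := by
    obtain ⟨m, hm⟩ := pow_unbounded_of_one_lt (‖η‖ / r) (one_lt_two (α := ℝ))
    exact ⟨m, by rwa [div_lt_iff₀ hr] at hm⟩
  classical
  let m := Nat.find hex
  have hm : ‖η‖ < 2 ^ m * r := Nat.find_spec hex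
  refine le_trans ?_ (ENNReal.le_tsum m)
  rw [Set.indicator_of_mem (by simpa using hm)]
  refine ENNReal.ofReal_le_ofReal ?_
  rcases Nat.eq_zero_or_pos m with h0 | hpos
  · rw [h0]
    simp only [zero_mul, pow_zero, inv_one, mul_one]
    exact (inv_le_one_of_one_le₀ (one_le_pow₀ (by have := div_nonneg (norm_nonneg η) hr.le; linarith))).trans
      (one_le_pow₀ one_le_two)
  · have h1 : 2 ^ (m - 1) * r ≤ ‖η‖ := not_lt.1 (Nat.find_min hex (m := m - 1) (by omega))
    have h2 : (2 : ℝ) ^ m ≤ 2 * (1 + ‖η‖ / r) := by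
      rw [← le_div_iff₀ hr] at h1
      have : (2 : ℝ) ^ m = 2 * 2 ^ (m - 1) := by rw [← pow_succ']; congr; omega
      linarith
    have h3 : (2 : ℝ) ^ (m * K) ≤ 2 ^ K * (1 + ‖η‖ / r) ^ K := by
      rw [pow_mul, ← mul_pow]; gcongr
    have h5 : 0 < 1 + ‖η‖ / r := by positivity
    rw [← div_eq_mul_inv, le_div_iff₀ (by positivity), inv_mul_le_iff₀ (by positivity),
      mul_comm ((1 + ‖η‖ / r) ^ K)]
    exact h3

/-- The mass on the ball of radius `2^m r` grows like `2^{mn}` and the weight there is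
`2^{-m(n+1)}`, leaving a geometric series. Keeping `ε` explicit lets the same bound give
integrability (`ε = 1`) and smallness (`ε → 0`). -/
lemma lintegral_mul_inv_pow_le {n : ℕ} {g : E n → ℂ} (hg : AEStronglyMeasurable g volume)
    {ε r : ℝ} (hε : 0 ≤ ε) (hr : 0 < r)
    (h : ∀ R ≥ r, ∫⁻ ξ in Metric.ball (0 : E n) R, ‖g ξ‖ₑ ≤ ENNReal.ofReal (ε * R ^ n)) :
    ∫⁻ η, ‖g η‖ₑ * ENNReal.ofReal (((1 + ‖η‖ / r) ^ (n + 1))⁻¹) ≤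
      ENNReal.ofReal (2 ^ (n + 2) * (ε * r ^ n)) := by
  calc _ ≤ ∫⁻ η, ∑' m : ℕ, (Metric.ball (0 : E n) (2 ^ m * r)).indicator
        (fun η => ENNReal.ofReal (2 ^ (n + 1) * ((2 : ℝ) ^ (m * (n + 1)))⁻¹) * ‖g η‖ₑ) η := by
        refine lintegral_mono fun η => ?_
        refine (mul_le_mul_right (inv_pow_le_tsum_indicator_ball (n + 1) hr η) _).trans_eq ?_
        rw [← ENNReal.tsum_mul_left]
        congr 1 with m
        by_cases hm : η ∈ Metric.ball (0 : E n) (2 ^ m * r)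
        · simp only [Set.indicator_of_mem hm]; ring
        · simp only [Set.indicator_of_notMem hm, mul_zero]
    _ = ∑' m : ℕ, ENNReal.ofReal (2 ^ (n + 1) * ((2 : ℝ) ^ (m * (n + 1)))⁻¹) *
          ∫⁻ η in Metric.ball (0 : E n) (2 ^ m * r), ‖g η‖ₑ := by
        rw [lintegral_tsum fun m => (hg.enorm.const_mul _).indicator measurableSet_ball]
        congr 1 with m
        rw [lintegral_indicator measurableSet_ball, lintegral_const_mul' _ _ ENNReal.ofReal_ne_top]
    _ ≤ ∑' m : ℕ, ENNReal.ofReal (2 ^ (n + 1) * (ε * r ^ n) * (1 / 2) ^ m) := by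
        refine ENNReal.tsum_le_tsum fun m => ?_
        have h1 : r ≤ 2 ^ m * r := le_mul_of_one_le_left hr.le (one_le_pow₀ one_le_two)
        refine (mul_le_mul_right (h _ h1) _).trans_eq ?_
        rw [← ENNReal.ofReal_mul (by positivity)]
        congr 1
        rw [mul_pow, ← pow_mul, one_div, inv_pow, mul_add, mul_one, pow_add _ (m * n) m]
        field_simp
    _ = _ := by
        rw [← ENNReal.ofReal_tsum_of_nonneg (fun m => by positivity)
          (summable_geometric_two.mul_left _), tsum_mul_left, tsum_geometric_two]
        congr 1
        ring

/-- Integrability against the weight `(1 + |ξ|)^{-(n+1)}`. -/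
lemma MeanZero.integrable_mul_weight {n : ℕ} {g : E n → ℂ} (hg : MeanZero g) :
    Integrable (fun η => ‖g η‖ * ((1 + ‖η‖) ^ (n + 1))⁻¹) := by
  have hm := hg.locallyIntegrable.aestronglyMeasurable
  have hw : Continuous fun η : E n => ((1 + ‖η‖) ^ (n + 1))⁻¹ :=
    Continuous.inv₀ (by fun_prop) fun η => by positivity
  refine ⟨hm.norm.mul hw.aestronglyMeasurable, ?_⟩
  obtain ⟨r, hr⟩ := ((hg.lintegral_ball_le one_pos).and (eventually_ge_atTop 1)).exists_forall_of_atTop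
  have hmax : 1 ≤ r := (hr r le_rfl).2
  refine lt_of_le_of_lt ?_ ((lintegral_mul_inv_pow_le hm zero_le_one (r := r) (by linarith)
    fun R hR => (hr R hR).1).trans_lt ENNReal.ofReal_lt_top)
  refine lintegral_mono fun η => ?_
  rw [enorm_mul, enorm_norm]
  gcongr
  rw [Real.enorm_eq_ofReal (by positivity)]
  refine ENNReal.ofReal_le_ofReal ?_
  have : ‖η‖ / r ≤ ‖η‖ := div_le_self (norm_nonneg _) hmax
  have h0 : 0 ≤ ‖η‖ / r := by positivity
  gcongr

lemma MeanZero.integrable_mul {n : ℕ} {g u : E n → ℂ} (hg : MeanZero g)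
    (hu : AEStronglyMeasurable u volume) {C : ℝ} (hC : ∀ η, (1 + ‖η‖) ^ (n + 1) * ‖u η‖ ≤ C) :
    Integrable (fun η => g η * u η) := by
  refine (hg.integrable_mul_weight.mul_const C).mono'
    (hg.locallyIntegrable.aestronglyMeasurable.mul hu) (ae_of_all _ fun η => ?_)
  rw [norm_mul, mul_assoc]
  gcongr
  rw [← div_eq_inv_mul, le_div_iff₀ (by positivity), mul_comm]
  exact hC η

lemma exists_schwartz_decay {n : ℕ} (a : 𝓢(E n, ℂ)) (K : ℕ) :
    ∃ C : ℝ, 0 ≤ C ∧ ∀ x, (1 + ‖x‖) ^ K * ‖a x‖ ≤ C := by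
  refine ⟨2 ^ K * ((Finset.Iic (K, 0)).sup fun m => SchwartzMap.seminorm ℝ m.1 m.2) a,
    mul_nonneg (by positivity) (apply_nonneg _ _), fun x => ?_⟩
  simpa using SchwartzMap.one_add_le_sup_seminorm_apply (𝕜 := ℝ) (m := (K, 0)) le_rfl le_rfl a x

lemma MeanZero.integrable_mul_schwartz {n : ℕ} {g : E n → ℂ} (hg : MeanZero g) (u : 𝓢(E n, ℂ)) :
    Integrable (fun η => g η * u η) :=
  hg.integrable_mul u.continuous.aestronglyMeasurable (exists_schwartz_decay u _).choose_spec.2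

/-- The functions `u N` are `L¹`-normalised bumps of width `2^N`, so these integrals are essentially
means of `g` over large balls. For constant `g` the conclusion can fail; it is here that polynomial
parts are excluded. -/
lemma MeanZero.tendsto_lowFrequency {n : ℕ} {g : E n → ℂ} (hg : MeanZero g) {u : ℕ → E n → ℂ}
    {C : ℝ} (hC : 0 ≤ C)
    (hu : ∀ N : ℕ, ∀ η, ‖u N η‖ ≤ ((2 : ℝ) ^ (N * n))⁻¹ * (C * ((1 + ‖η‖ / 2 ^ N) ^ (n + 1))⁻¹)) :
    Tendsto (fun N => ∫ η, g η * u N η) atTop (𝓝 0) := by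
  rw [tendsto_zero_iff_norm_tendsto_zero, Metric.tendsto_atTop]
  intro ε hε
  obtain ⟨δ, hδ, hδε⟩ : ∃ δ > 0, 2 ^ (n + 2) * δ * C < ε := by
    refine ⟨ε / (2 ^ (n + 2) * (C + 1)), by positivity, ?_⟩
    rw [mul_div_assoc', mul_div_mul_left _ _ (by positivity), div_mul_eq_mul_div,
      div_lt_iff₀ (by positivity)]
    nlinarith
  obtain ⟨r, hr⟩ := (hg.lintegral_ball_le hδ).exists_forall_of_atTop
  obtain ⟨N₀, hN₀⟩ := pow_unbounded_of_one_lt r (one_lt_two (α := ℝ))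
  refine ⟨N₀, fun N hN => ?_⟩
  have hrN : r ≤ 2 ^ N := hN₀.le.trans (pow_le_pow_right₀ one_le_two hN)
  have h1 := lintegral_mul_inv_pow_le hg.locallyIntegrable.aestronglyMeasurable hδ.le
    (r := 2 ^ N) (by positivity) fun R hR => hr R (hrN.trans hR)
  have h2 : ‖∫ η, g η * u N η‖ₑ ≤ ENNReal.ofReal (2 ^ (n + 2) * δ * C) := by
    refine (enorm_integral_le_lintegral_enorm _).trans ?_
    calc _ ≤ ∫⁻ η, ENNReal.ofReal (((2 : ℝ) ^ (N * n))⁻¹ * C) *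
          (‖g η‖ₑ * ENNReal.ofReal (((1 + ‖η‖ / 2 ^ N) ^ (n + 1))⁻¹)) := by
          refine lintegral_mono fun η => ?_
          rw [enorm_mul, mul_left_comm, ← ENNReal.ofReal_mul (by positivity), ← ofReal_norm (u N η)]
          gcongr
          rw [mul_assoc]
          exact hu N η
      _ ≤ ENNReal.ofReal (((2 : ℝ) ^ (N * n))⁻¹ * C) *
            ENNReal.ofReal (2 ^ (n + 2) * (δ * (2 ^ N) ^ n)) := by
          rw [lintegral_const_mul' _ _ ENNReal.ofReal_ne_top]
          gcongr
      _ = _ := by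
          rw [← ENNReal.ofReal_mul (by positivity)]
          congr 1
          rw [← pow_mul]
          field_simp
  rw [dist_zero_right, norm_norm]
  rw [← ofReal_norm, ENNReal.ofReal_le_ofReal_iff (by positivity)] at h2
  exact h2.trans_lt hδε

lemma mul_one_add_norm_le {n : ℕ} (ξ η : E n) : 1 + ‖η‖ ≤ (1 + ‖ξ - η‖) * (1 + ‖ξ‖) := by
  have h : ‖η‖ ≤ ‖ξ‖ + ‖ξ - η‖ := by
    calc ‖η‖ = ‖ξ - (ξ - η)‖ := by rw [sub_sub_cancel]
      _ ≤ _ := norm_sub_le _ _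
  nlinarith [norm_nonneg ξ, norm_nonneg (ξ - η)]

lemma aestronglyMeasurable_sub_mul {n : ℕ} {g : E n → ℂ} (hg : AEStronglyMeasurable g volume)
    (a : 𝓢(E n, ℂ)) :
    AEStronglyMeasurable (fun z : E n × E n => a (z.1 - z.2) * g z.2) (volume.prod volume) :=
  (a.continuous.comp (continuous_fst.sub continuous_snd)).aestronglyMeasurable.mul
    (hg.comp_quasiMeasurePreserving Measure.quasiMeasurePreserving_snd)

/-- Justifies Fubini when `P_l` is moved across a pairing. The decay of `b` is spent twice: one
power `n + 1` makes it integrable in the first variable, the other turns the decay of `a` at `ξ - η`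
into decay in `η`. -/
lemma MeanZero.integrable_prod {n : ℕ} {g : E n → ℂ} (hg : MeanZero g) (a b : 𝓢(E n, ℂ)) :
    Integrable (fun z : E n × E n => a (z.1 - z.2) * g z.2 * b z.1) (volume.prod volume) := by
  obtain ⟨A, hA, ha⟩ := exists_schwartz_decay a (n + 1)
  obtain ⟨B, hB, hb⟩ := exists_schwartz_decay b (n + 1 + (n + 1))
  have hw : Integrable (fun ξ : E n => ((1 + ‖ξ‖) ^ (n + 1))⁻¹) := by
    have := integrable_one_add_norm (E := E n) (μ := volume) (r := (n + 1 : ℕ)) (by simp)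
    refine this.congr (ae_of_all _ fun ξ => ?_)
    simp only
    rw [Real.rpow_neg (by positivity), Real.rpow_natCast]
  refine ((hw.mul_prod hg.integrable_mul_weight).const_mul (A * B)).mono'
    ((aestronglyMeasurable_sub_mul hg.locallyIntegrable.aestronglyMeasurable a).mul
      (b.continuous.comp continuous_fst).aestronglyMeasurable) (ae_of_all _ fun z => ?_)
  obtain ⟨ξ, η⟩ := z
  simp only [norm_mul]
  have h1 := ha (ξ - η)
  have h2 := hb ξ
  have h3 : (1 + ‖η‖) ^ (n + 1) ≤ (1 + ‖ξ - η‖) ^ (n + 1) * (1 + ‖ξ‖) ^ (n + 1) := by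
    rw [← mul_pow]
    gcongr
    exact mul_one_add_norm_le ξ η
  have h4 : (1 + ‖ξ‖) ^ (n + 1) * (1 + ‖η‖) ^ (n + 1) * (‖a (ξ - η)‖ * ‖b ξ‖) ≤ A * B := by
    calc _ ≤ (1 + ‖ξ‖) ^ (n + 1) * ((1 + ‖ξ - η‖) ^ (n + 1) * (1 + ‖ξ‖) ^ (n + 1)) *
          (‖a (ξ - η)‖ * ‖b ξ‖) := by gcongr
      _ = ((1 + ‖ξ - η‖) ^ (n + 1) * ‖a (ξ - η)‖) *
          ((1 + ‖ξ‖) ^ (n + 1 + (n + 1)) * ‖b ξ‖) := by ring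
      _ ≤ A * B := by gcongr
  rw [← le_div_iff₀' (by positivity)] at h4
  calc _ = (‖a (ξ - η)‖ * ‖b ξ‖) * ‖g η‖ := by ring
    _ ≤ (A * B / ((1 + ‖ξ‖) ^ (n + 1) * (1 + ‖η‖) ^ (n + 1))) * ‖g η‖ := by gcongr
    _ = _ := by
      rw [div_eq_mul_inv, mul_inv]
      ring

/-! ### Littlewood-Paley pieces in duality with Schwartz functions. -/

lemma lpProj_eq {n : ℕ} {χ : E n → ℝ} (hχ : IsCutoff χ) (l : ℤ) (g : E n → ℂ) (ξ : E n) :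
    lpProj χ l g ξ = (2 : ℂ) ^ (l * (n : ℤ)) *
      ∫ η, dil l (𝓕 (annS hχ)) (ξ - η) * g η := by
  rw [lpProj, ← annS_coe hχ]
  rfl

lemma aestronglyMeasurable_lpProj {n : ℕ} {χ : E n → ℝ} (hχ : IsCutoff χ) (l : ℤ) {g : E n → ℂ}
    (hg : AEStronglyMeasurable g volume) : AEStronglyMeasurable (lpProj χ l g) volume := by
  have : lpProj χ l g = fun ξ => (2 : ℂ) ^ (l * (n : ℤ)) *
      ∫ η, dil l (𝓕 (annS hχ)) (ξ - η) * g η := funext (lpProj_eq hχ l g)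
  rw [this]
  exact (aestronglyMeasurable_sub_mul hg _).integral_prod_right'.const_mul _

lemma annS_neg {n : ℕ} {χ : E n → ℝ} (hχ : IsCutoff χ) (x : E n) : annS hχ (-x) = annS hχ x := by
  simp [annS_apply, annular, hχ.even]

/-- Since `φ` is even, so is its Fourier transform, hence `P_l` is symmetric for the bilinear
pairing. On `𝓕 h` it acts as multiplication of `h` by `φ(2^{-l}·)`. -/
lemma integral_lpProj_mul_fourier {n : ℕ} {χ : E n → ℝ} (hχ : IsCutoff χ) (l : ℤ) {g : E n → ℂ}
    (hg : MeanZero g) (h : 𝓢(E n, ℂ)) :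
    ∫ ξ, lpProj χ l g ξ * 𝓕 h ξ = ∫ η, g η * 𝓕 (mulS h (dil (-l) (annS hχ))) η := by
  calc _ = (2 : ℂ) ^ (l * (n : ℤ)) *
        ∫ ξ, ∫ η, dil l (𝓕 (annS hχ)) (ξ - η) * g η * 𝓕 h ξ := by
        rw [← integral_const_mul]
        refine integral_congr_ae (ae_of_all _ fun ξ => ?_)
        simp only [lpProj_eq hχ]
        rw [integral_mul_const, mul_assoc]
    _ = (2 : ℂ) ^ (l * (n : ℤ)) *
        ∫ η, ∫ ξ, dil l (𝓕 (annS hχ)) (ξ - η) * g η * 𝓕 h ξ := by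
        rw [integral_integral_swap (hg.integrable_prod _ _)]
    _ = _ := by
        rw [← integral_const_mul]
        refine integral_congr_ae (ae_of_all _ fun η => ?_)
        simp only
        rw [← lpProj_fourier hχ l h η, lpProj_eq hχ, mul_left_comm, ← integral_const_mul (g η)]
        congr 1
        refine integral_congr_ae (ae_of_all _ fun ξ => ?_)
        have : dil l (𝓕 (annS hχ)) (ξ - η) = dil l (𝓕 (annS hχ)) (η - ξ) := by
          rw [dil_apply, dil_apply, ← fourier_neg (annS_neg hχ), ← smul_neg, neg_sub]
        simp only [this]
        ring

lemma dil_annS {n : ℕ} {χ : E n → ℝ} (hχ : IsCutoff χ) (l : ℤ) :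
    dil l (annS hχ) = dil l (cutS hχ) - dil (l + 1) (cutS hχ) := by
  ext y
  simp [annS, smul_smul, zpow_add₀, mul_comm]

lemma mulS_sub {n : ℕ} (a b c : 𝓢(E n, ℂ)) : mulS a (b - c) = mulS a b - mulS a c := by
  simp [mulS]

lemma fourier_sub_apply {n : ℕ} (a b : 𝓢(E n, ℂ)) (x : E n) :
    𝓕 (a - b) x = 𝓕 a x - 𝓕 b x := by
  have : 𝓕 (a - b) = 𝓕 a - 𝓕 b := by
    simpa using map_sub (FourierTransform.fourierCLM ℂ 𝓢(E n, ℂ)) a b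
  rw [this]; rfl

lemma mulS_dil_eq {n : ℕ} (l : ℤ) (a b : 𝓢(E n, ℂ)) :
    mulS a (dil l b) = dil l (mulS b (dil (-l) a)) := by
  ext y
  simp only [mulS_apply, dil_apply, smul_smul, ← zpow_add₀ (two_ne_zero (α := ℝ)), neg_add_cancel,
    zpow_zero, one_smul, mul_comm]

lemma tendsto_fourier_mulS_cutS {n : ℕ} {χ : E n → ℝ} (hχ : IsCutoff χ) (h : 𝓢(E n, ℂ))
    (ζ : E n) :
    Tendsto (fun N : ℕ => 𝓕 (mulS h (dil (-(N : ℤ)) (cutS hχ))) ζ) atTop (𝓝 (𝓕 h ζ)) := by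
  simp only [SchwartzMap.fourier_coe, fourier_apply]
  obtain ⟨C, hC, hc⟩ := exists_schwartz_decay (cutS hχ) 0
  refine tendsto_integral_of_dominated_convergence (fun y => ‖h y‖ * C) (fun N => ?_)
    (h.integrable.norm.mul_const C) (fun N => ae_of_all _ fun y => ?_) (ae_of_all _ fun y => ?_)
  · refine Continuous.aestronglyMeasurable ?_
    have := (mulS h (dil (-(N : ℤ)) (cutS hχ))).continuous
    fun_prop
  · have he : ‖Complex.exp (-(2 * (Real.pi : ℂ) * Complex.I * ((inner ℝ y ζ : ℝ) : ℂ)))‖ = 1 := by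
      rw [Complex.norm_exp]
      simp
    rw [norm_mul, he, one_mul, mulS_apply, norm_mul, dil_apply]
    gcongr
    simpa using hc (((2 : ℝ) ^ (-(N : ℤ))) • y)
  · refine Tendsto.const_mul _ (tendsto_const_nhds.congr' ?_)
    obtain ⟨N₀, hN₀⟩ := pow_unbounded_of_one_lt ‖y‖ (one_lt_two (α := ℝ))
    filter_upwards [eventually_ge_atTop N₀] with N hN
    have : χ (((2 : ℝ) ^ (-(N : ℤ))) • y) = 1 := by
      refine hχ.eq_one _ ?_
      rw [norm_smul, zpow_neg, zpow_natCast, Real.norm_of_nonneg (by positivity),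
        inv_mul_le_iff₀ (by positivity), mul_one]
      exact hN₀.le.trans (pow_le_pow_right₀ one_le_two hN)
    rw [mulS_apply, dil_apply, cutS_apply, this, Complex.ofReal_one, mul_one]

/-- Dominated convergence: the cutoffs `χ(2^{-N}·)` have bounded derivatives, so the Fourier
transforms decay uniformly in `N`. -/
lemma MeanZero.tendsto_highFrequency {n : ℕ} {χ : E n → ℝ} (hχ : IsCutoff χ) {g : E n → ℂ}
    (hg : MeanZero g) (h : 𝓢(E n, ℂ)) :
    Tendsto (fun N : ℕ => ∫ η, g η * 𝓕 (mulS h (dil (-(N : ℤ)) (cutS hχ))) η) atTop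
      (𝓝 (∫ η, g η * 𝓕 h η)) := by
  obtain ⟨C, hC, hc⟩ := exists_fourier_mulS_dil_decay h (cutS hχ) (n + 1)
  refine tendsto_integral_of_dominated_convergence
    (fun η => ‖g η‖ * ((1 + ‖η‖) ^ (n + 1))⁻¹ * C) (fun N => ?_)
    (hg.integrable_mul_weight.mul_const C) (fun N => ae_of_all _ fun η => ?_)
    (ae_of_all _ fun η => (tendsto_fourier_mulS_cutS hχ h η).const_mul _)
  · exact (hg.integrable_mul_schwartz _).aestronglyMeasurable
  · rw [norm_mul, mul_assoc]
    gcongr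
    rw [← div_eq_inv_mul, le_div_iff₀ (by positivity), mul_comm]
    exact hc (-(N : ℤ)) (by simp) η

/-- Rescaling by `2^N` exchanges the roles of the factors: `χ` becomes fixed and `h` is stretched,
so its derivatives stay bounded. Undoing the scaling produces the normalised bumps of width `2^N`.
-/
lemma MeanZero.tendsto_lowFrequency_cutS {n : ℕ} {χ : E n → ℝ} (hχ : IsCutoff χ) {g : E n → ℂ}
    (hg : MeanZero g) (h : 𝓢(E n, ℂ)) :
    Tendsto (fun N : ℕ => ∫ η, g η * 𝓕 (mulS h (dil (N : ℤ) (cutS hχ))) η) atTop (𝓝 0) := by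
  obtain ⟨C, hC, hc⟩ := exists_fourier_mulS_dil_decay (cutS hχ) h (n + 1)
  refine hg.tendsto_lowFrequency hC fun N η => ?_
  rw [mulS_dil_eq, fourier_dil, norm_mul]
  have h1 := hc (-(N : ℤ)) (by simp) (((2 : ℝ) ^ (-(N : ℤ))) • η)
  rw [norm_smul, Real.norm_of_nonneg (by positivity)] at h1
  have h2 : (2 : ℝ) ^ (-(N : ℤ)) * ‖η‖ = ‖η‖ / 2 ^ N := by
    rw [zpow_neg, zpow_natCast, div_eq_inv_mul]
  rw [h2] at h1
  gcongr
  · rw [norm_zpow, Complex.norm_ofNat, neg_mul, zpow_neg]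
    exact le_of_eq (by norm_cast)
  · rw [← div_eq_mul_inv, le_div_iff₀ (by positivity), mul_comm]
    exact h1

/-- The Littlewood-Paley decomposition, tested against a Schwartz function. -/
lemma MeanZero.enorm_integral_mul_fourier_le {n : ℕ} {χ : E n → ℝ} (hχ : IsCutoff χ)
    {g : E n → ℂ} (hg : MeanZero g) (h : 𝓢(E n, ℂ)) :
    ‖∫ η, g η * 𝓕 h η‖ₑ ≤ ∑' l : ℤ, ‖∫ η, g η * 𝓕 (mulS h (dil (-l) (annS hχ))) η‖ₑ := by
  set D : ℤ → ℂ := fun l => ∫ η, g η * 𝓕 (mulS h (dil (-l) (cutS hχ))) η with hD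
  have hdiff (l : ℤ) : ∫ η, g η * 𝓕 (mulS h (dil (-l) (annS hχ))) η = D l - D (l - 1) := by
    rw [hD, ← integral_sub (hg.integrable_mul_schwartz _) (hg.integrable_mul_schwartz _)]
    refine integral_congr_ae (ae_of_all _ fun η => ?_)
    simp only [dil_annS, mulS_sub, fourier_sub_apply]
    rw [mul_sub, neg_sub, sub_eq_neg_add 1 l, neg_add_eq_sub, sub_eq_neg_add]
  have hsum (N : ℕ) : ‖D N - D (-(N : ℤ))‖ₑ ≤
      ∑' l : ℤ, ‖∫ η, g η * 𝓕 (mulS h (dil (-l) (annS hχ))) η‖ₑ := by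
    -- The shift by one makes the `2N` indices run over `-N < l ≤ N`.
    have htel : D N - D (-(N : ℤ)) = ∑ i ∈ Finset.range (2 * N),
        ∫ η, g η * 𝓕 (mulS h (dil (-((i : ℤ) - N + 1)) (annS hχ))) η := by
      have := Finset.sum_range_sub (fun i : ℕ => D ((i : ℤ) - N)) (2 * N)
      simp only [Nat.cast_zero, zero_sub] at this
      rw [show ((2 * N : ℕ) : ℤ) - N = N by push_cast; ring] at this
      rw [← this]
      refine Finset.sum_congr rfl fun i _ => ?_
      rw [hdiff]
      congr 2 <;> push_cast <;> ring
    rw [htel]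
    refine (enorm_sum_le _ _).trans ((ENNReal.sum_le_tsum _).trans ?_)
    exact ENNReal.tsum_comp_le_tsum_of_injective (f := fun i : ℕ => (i : ℤ) - N + 1)
      (fun i j hij => by simpa using hij)
      (fun l : ℤ => ‖∫ η, g η * 𝓕 (mulS h (dil (-l) (annS hχ))) η‖ₑ)
  have hlim := (hg.tendsto_highFrequency hχ h).sub (hg.tendsto_lowFrequency_cutS hχ h)
  rw [sub_zero] at hlim
  refine le_of_tendsto hlim.enorm (Eventually.of_forall fun N => ?_)
  simpa [hD] using hsum N

/-! ### The `L²` bound and the extension of `T_σ`. -/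

lemma eLpNorm_fourier {n : ℕ} (u : 𝓢(E n, ℂ)) :
    eLpNorm (𝓕 u : 𝓢(E n, ℂ)) 2 volume = eLpNorm u 2 volume := by
  have h := SchwartzMap.norm_fourier_toL2_eq u
  rw [SchwartzMap.norm_toLp, SchwartzMap.norm_toLp] at h
  exact (ENNReal.toReal_eq_toReal_iff' (SchwartzMap.eLpNorm_lt_top _ _ _).ne
    (SchwartzMap.eLpNorm_lt_top _ _ _).ne).1 h

lemma enorm_integral_mul_le_eLpNorm {n : ℕ} {u v : E n → ℂ} (hu : AEStronglyMeasurable u volume)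
    (hv : AEStronglyMeasurable v volume) :
    ‖∫ ξ, u ξ * v ξ‖ₑ ≤ eLpNorm u 2 volume * eLpNorm v 2 volume := by
  refine (enorm_integral_le_lintegral_enorm _).trans ?_
  simp only [enorm_mul]
  have := ENNReal.lintegral_mul_le_Lp_mul_Lq volume Real.HolderConjugate.two_two hu.enorm hv.enorm
  rw [eLpNorm_eq_lintegral_rpow_enorm_toReal two_ne_zero ENNReal.ofNat_ne_top,
    eLpNorm_eq_lintegral_rpow_enorm_toReal two_ne_zero ENNReal.ofNat_ne_top]
  simpa using this

/-- `φ` lives in `|y| ≤ 2` whereas `χ` equals `1` only up to `|y| = 1`, hence the extra dilation by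
`2`. The wider cutoff localises `h` after `φ` has been transferred to `g`. -/
lemma mulS_mulS_cutS {n : ℕ} {χ : E n → ℝ} (hχ : IsCutoff χ) (l : ℤ) (h : 𝓢(E n, ℂ)) :
    mulS (mulS h (dil (-l - 1) (cutS hχ))) (dil (-l) (annS hχ)) =
      mulS h (dil (-l) (annS hχ)) := by
  ext y
  simp only [mulS_apply, dil_apply, annS_apply, cutS_apply]
  by_cases hy : 2 < ‖((2 : ℝ) ^ (-l)) • y‖
  · rw [annular_eq_zero_of_gt hχ hy, mul_zero, mul_zero]
  · rw [hχ.eq_one, Complex.ofReal_one, mul_one]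
    rw [zpow_sub₀ two_ne_zero, zpow_one, div_eq_inv_mul, mul_smul, norm_smul]
    norm_num at hy ⊢
    linarith

lemma enorm_integral_mul_fourier_le_eLpNorm {n : ℕ} {χ : E n → ℝ} (hχ : IsCutoff χ) (l : ℤ)
    {g : E n → ℂ} (hg : MeanZero g) (h : 𝓢(E n, ℂ)) :
    ‖∫ η, g η * 𝓕 (mulS h (dil (-l) (annS hχ))) η‖ₑ ≤
      eLpNorm (lpProj χ l g) 2 volume *
        eLpNorm (mulS h (dil (-l - 1) (cutS hχ))) 2 volume := by
  rw [← mulS_mulS_cutS, ← integral_lpProj_mul_fourier hχ l hg, ← eLpNorm_fourier]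
  exact enorm_integral_mul_le_eLpNorm
    (aestronglyMeasurable_lpProj hχ l hg.locallyIntegrable.aestronglyMeasurable)
    (SchwartzMap.continuous _).aestronglyMeasurable

/-- The translate `y ↦ f (y + x)` of a Schwartz function. -/
def transl {n : ℕ} (x : E n) (f : 𝓢(E n, ℂ)) : 𝓢(E n, ℂ) :=
  SchwartzMap.compSubConstCLM ℂ (-x) f

@[simp] lemma transl_apply {n : ℕ} (x : E n) (f : 𝓢(E n, ℂ)) (y : E n) :
    transl x f y = f (y + x) := by
  simp [transl]

lemma fourier_transl {n : ℕ} (x : E n) (f : 𝓢(E n, ℂ)) (ξ : E n) :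
    𝓕 (transl x f) ξ =
      Complex.exp (2 * (Real.pi : ℂ) * Complex.I * ((inner ℝ ξ x : ℝ) : ℂ)) * 𝓕 f ξ := by
  have h := integral_add_right_eq_self (μ := (volume : Measure (E n))) (fun y =>
    Complex.exp (2 * (Real.pi : ℂ) * Complex.I * ((inner ℝ ξ x : ℝ) : ℂ)) *
      (Complex.exp (-(2 * (Real.pi : ℂ) * Complex.I * ((inner ℝ y ξ : ℝ) : ℂ))) * f y)) x
  rw [SchwartzMap.fourier_coe, SchwartzMap.fourier_coe, fourier_apply, fourier_apply,
    ← integral_const_mul, ← h]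
  refine integral_congr_ae (ae_of_all _ fun y => ?_)
  simp only [transl_apply, inner_add_left, real_inner_comm ξ x]
  rw [← mul_assoc, ← Complex.exp_add]
  congr 2
  push_cast
  ring

lemma pdo_eq {n : ℕ} (σ : E n → E n → ℂ) (f : 𝓢(E n, ℂ)) (x : E n) :
    pdo σ f x = ∫ ξ, σ x ξ * 𝓕 (transl x f) ξ := by
  simp only [fourier_transl, pdo, ← mul_assoc]
  rfl

lemma lintegral_comp_smul {n : ℕ} {f : E n → ℝ≥0∞} (hf : Measurable f) {r : ℝ} (hr : 0 < r) :
    ∫⁻ x, f (r • x) = ENNReal.ofReal ((r ^ n)⁻¹) * ∫⁻ x, f x := by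
  rw [← lintegral_map hf (measurable_const_smul r), Measure.map_addHaar_smul _ hr.ne',
    lintegral_smul_measure, finrank_euclideanSpace, Fintype.card_fin, abs_of_pos (by positivity)]
  rfl

lemma eLpNorm_two {n : ℕ} {F : Type*} [ENorm F] (u : E n → F) :
    eLpNorm u 2 volume = (∫⁻ x, ‖u x‖ₑ ^ 2) ^ (1 / 2 : ℝ) := by
  rw [eLpNorm_eq_lintegral_rpow_enorm_toReal two_ne_zero ENNReal.ofNat_ne_top]
  simp

/-- Minkowski's inequality for countable sums. -/
lemma lintegral_tsum_sq_le {α ι : Type*} [MeasurableSpace α] [Countable ι] {μ : Measure α}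
    {F : ι → α → ℝ≥0∞} (hF : ∀ i, AEMeasurable (F i) μ) :
    (∫⁻ x, (∑' i, F i x) ^ 2 ∂μ) ^ (1 / 2 : ℝ) ≤ ∑' i, (∫⁻ x, F i x ^ 2 ∂μ) ^ (1 / 2 : ℝ) := by
  classical
  have hfin (s : Finset ι) : (∫⁻ x, (∑ i ∈ s, F i x) ^ 2 ∂μ) ^ (1 / 2 : ℝ) ≤
      ∑ i ∈ s, (∫⁻ x, F i x ^ 2 ∂μ) ^ (1 / 2 : ℝ) := by
    induction s using Finset.induction_on with
    | empty => simp
    | insert i s hi ih =>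
      simp only [Finset.sum_insert hi]
      have := ENNReal.lintegral_Lp_add_le (hF i)
        (Finset.aemeasurable_fun_sum s fun i _ => hF i) (one_le_two (α := ℝ))
      simp only [Pi.add_apply, ENNReal.rpow_two] at this
      exact this.trans (by gcongr)
  have hsup : ∫⁻ x, (∑' i, F i x) ^ 2 ∂μ = ⨆ s : Finset ι, ∫⁻ x, (∑ i ∈ s, F i x) ^ 2 ∂μ := by
    rw [← lintegral_iSup_directed
      (fun s => (Finset.aemeasurable_fun_sum s fun i _ => hF i).pow_const 2)]
    · refine lintegral_congr fun x => ?_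
      have := (ENNReal.orderIsoRpow 2 two_pos).map_iSup fun s : Finset ι => ∑ i ∈ s, F i x
      rw [ENNReal.tsum_eq_iSup_sum]
      simpa only [ENNReal.orderIsoRpow_apply, ENNReal.rpow_two] using this
    · refine directed_of_isDirected_le fun s t hst x => ?_
      dsimp only
      gcongr
  have h2 := (ENNReal.orderIsoRpow (1 / 2) one_half_pos).map_iSup
    fun s : Finset ι => ∫⁻ x, (∑ i ∈ s, F i x) ^ 2 ∂μ
  simp only [ENNReal.orderIsoRpow_apply] at h2
  rw [hsup, h2]
  exact iSup_le fun s => (hfin s).trans (ENNReal.sum_le_tsum s)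

lemma lintegral_mulS_transl {n : ℕ} (f a : 𝓢(E n, ℂ)) :
    ∫⁻ x, ∫⁻ y, ‖mulS (transl x f) a y‖ₑ ^ 2 = (∫⁻ x, ‖f x‖ₑ ^ 2) * ∫⁻ y, ‖a y‖ₑ ^ 2 := by
  have hf := f.continuous
  have ha := a.continuous
  rw [lintegral_lintegral_swap]
  · simp only [mulS_apply, transl_apply, enorm_mul, mul_pow]
    calc _ = ∫⁻ y, (∫⁻ x, ‖f x‖ₑ ^ 2) * ‖a y‖ₑ ^ 2 := by
          refine lintegral_congr fun y => ?_
          have hc : Continuous fun x => ‖f (y + x)‖ₑ ^ 2 := by fun_prop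
          rw [lintegral_mul_const _ hc.measurable]
          congr 1
          exact lintegral_add_left_eq_self (fun x => ‖f x‖ₑ ^ 2) y
      _ = _ := lintegral_const_mul _ (by fun_prop)
  · simp only [mulS_apply, transl_apply, Function.uncurry_def]
    exact Measurable.aemeasurable (by fun_prop)

lemma measurable_lintegral_mulS_transl {n : ℕ} (f a : 𝓢(E n, ℂ)) :
    Measurable fun x => ∫⁻ y, ‖mulS (transl x f) a y‖ₑ ^ 2 := by
  have hf := f.continuous
  have ha := a.continuous
  simp only [mulS_apply, transl_apply]
  exact Measurable.lintegral_prod_right' (f := fun z : E n × E n => ‖f (z.2 + z.1) * a z.2‖ₑ ^ 2)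
    (by fun_prop)

lemma lintegral_dil_sq {n : ℕ} (a : 𝓢(E n, ℂ)) (l : ℤ) :
    (∫⁻ y, ‖dil l a y‖ₑ ^ 2) ^ (1 / 2 : ℝ) =
      (2 : ℝ≥0∞) ^ (-(l : ℝ) * n / 2) * eLpNorm a 2 volume := by
  have ha := a.continuous
  have := lintegral_comp_smul (f := fun y => ‖a y‖ₑ ^ 2) (by fun_prop) (r := (2 : ℝ) ^ l)
    (by positivity)
  simp only [dil_apply]
  rw [this, ENNReal.mul_rpow_of_nonneg _ _ (by norm_num), eLpNorm_two]
  congr 1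
  have h2 : (2 : ℝ≥0∞) = ENNReal.ofReal 2 := by simp
  rw [h2, ENNReal.ofReal_rpow_of_pos (by positivity), ENNReal.ofReal_rpow_of_pos two_pos]
  congr 1
  rw [← Real.rpow_intCast, ← Real.rpow_natCast, ← Real.rpow_mul two_pos.le,
    ← Real.rpow_neg two_pos.le, ← Real.rpow_mul two_pos.le]
  congr 1
  ring

/-- Pointwise bound of `T_σ f` by the Littlewood-Paley pieces of the symbol. -/
lemma enorm_pdo_le {n : ℕ} {χ : E n → ℝ} (hχ : IsCutoff χ) {σ : E n → E n → ℂ} (hσ : IsSymbol σ)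
    (f : 𝓢(E n, ℂ)) (x : E n) :
    ‖pdo σ f x‖ₑ ≤ ∑' l : ℤ, (⨆ x, eLpNorm (lpProj χ l (σ x)) 2 volume) *
      (∫⁻ y, ‖mulS (transl x f) (dil (-l - 1) (cutS hχ)) y‖ₑ ^ 2) ^ (1 / 2 : ℝ) := by
  rw [pdo_eq]
  refine ((hσ.meanZero x).enorm_integral_mul_fourier_le hχ _).trans
    (ENNReal.tsum_le_tsum fun l => ?_)
  refine (enorm_integral_mul_fourier_le_eLpNorm hχ l (hσ.meanZero x) _).trans ?_
  rw [eLpNorm_two (mulS _ _)]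
  gcongr
  exact le_iSup (fun x => eLpNorm (lpProj χ l (σ x)) 2 volume) x

/-- The supremum over `x` is taken before integrating, so that only the localised norm of `f`
depends on `x`. That norm yields `2^{(l+1)n/2}`: the weight of `besovSup` times the constant
`2^{n/2}`. -/
lemma eLpNorm_pdo_le {n : ℕ} {χ : E n → ℝ} (hχ : IsCutoff χ) {σ : E n → E n → ℂ}
    (hσ : IsSymbol σ) (f : 𝓢(E n, ℂ)) :
    eLpNorm (pdo σ f) 2 volume ≤
      (2 : ℝ≥0∞) ^ ((n : ℝ) / 2) * eLpNorm (cutS hχ) 2 volume * besovSup χ σ *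
        eLpNorm f 2 volume := by
  set A : ℤ → ℝ≥0∞ := fun l => ⨆ x, eLpNorm (lpProj χ l (σ x)) 2 volume with hA
  set Q : ℤ → E n → ℝ≥0∞ := fun l x =>
    ∫⁻ y, ‖mulS (transl x f) (dil (-l - 1) (cutS hχ)) y‖ₑ ^ 2 with hQ
  have hQm (l : ℤ) : Measurable (Q l) := measurable_lintegral_mulS_transl _ _
  have hQint (l : ℤ) : (∫⁻ x, Q l x) ^ (1 / 2 : ℝ) = eLpNorm f 2 volume *
      ((2 : ℝ≥0∞) ^ ((l : ℝ) * n / 2) * (2 : ℝ≥0∞) ^ ((n : ℝ) / 2) *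
        eLpNorm (cutS hχ) 2 volume) := by
    rw [hQ, lintegral_mulS_transl, ENNReal.mul_rpow_of_nonneg _ _ (by norm_num),
      lintegral_dil_sq, ← eLpNorm_two, ← ENNReal.rpow_add _ _ two_ne_zero ENNReal.ofNat_ne_top]
    congr 3
    push_cast
    ring
  have hsq (a b : ℝ≥0∞) : (a * b ^ (1 / 2 : ℝ)) ^ 2 = a ^ 2 * b := by
    rw [mul_pow, ← ENNReal.rpow_two (b ^ _), ← ENNReal.rpow_mul]
    norm_num
  calc eLpNorm (pdo σ f) 2 volume
      ≤ (∫⁻ x, (∑' l : ℤ, A l * Q l x ^ (1 / 2 : ℝ)) ^ 2) ^ (1 / 2 : ℝ) := by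
        rw [eLpNorm_two]
        gcongr with x
        exact enorm_pdo_le hχ hσ f x
    _ ≤ ∑' l : ℤ, (∫⁻ x, (A l * Q l x ^ (1 / 2 : ℝ)) ^ 2) ^ (1 / 2 : ℝ) :=
        lintegral_tsum_sq_le fun l => (((hQm l).pow_const _).const_mul _).aemeasurable
    _ = ∑' l : ℤ, (2 : ℝ≥0∞) ^ ((n : ℝ) / 2) * eLpNorm (cutS hχ) 2 volume *
          eLpNorm f 2 volume * ((2 : ℝ≥0∞) ^ ((l : ℝ) * n / 2) * A l) := by
        congr 1 with l
        simp only [hsq]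
        rw [lintegral_const_mul _ (hQm l), ENNReal.mul_rpow_of_nonneg _ _ (by norm_num), hQint,
          ← ENNReal.rpow_two, ← ENNReal.rpow_mul]
        norm_num
        ring
    _ = _ := by
        rw [ENNReal.tsum_mul_left, besovSup]
        ring

/-- The constant of the `L²` bound. -/
def besovConst {n : ℕ} {χ : E n → ℝ} (hχ : IsCutoff χ) : NNReal :=
  -- Adding `1` makes the constant positive without a lower bound on the norm of `χ`.
  ((2 : ℝ≥0∞) ^ ((n : ℝ) / 2) * eLpNorm (cutS hχ) 2 volume).toNNReal + 1

lemma eLpNorm_pdo_le_besovConst {n : ℕ} {χ : E n → ℝ} (hχ : IsCutoff χ) {σ : E n → E n → ℂ}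
    (hσ : IsSymbol σ) (f : 𝓢(E n, ℂ)) :
    eLpNorm (pdo σ f) 2 volume ≤ besovConst hχ * besovSup χ σ * eLpNorm f 2 volume := by
  refine (eLpNorm_pdo_le hχ hσ f).trans ?_
  gcongr
  rw [besovConst, ENNReal.coe_add, ENNReal.coe_toNNReal]
  · exact le_self_add
  · exact ENNReal.mul_ne_top (ENNReal.rpow_ne_top_of_nonneg (by positivity) ENNReal.ofNat_ne_top)
      (SchwartzMap.eLpNorm_lt_top _ _ _).ne

lemma pdoNorm_le {n : ℕ} {χ : E n → ℝ} (hχ : IsCutoff χ) {σ : E n → E n → ℂ} (hσ : IsSymbol σ) :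
    pdoNorm σ ≤ besovConst hχ * besovSup χ σ :=
  iSup_le fun f => ENNReal.div_le_of_le_mul (eLpNorm_pdo_le_besovConst hχ hσ f)

lemma aestronglyMeasurable_pdo {n : ℕ} {σ : E n → E n → ℂ} (hσ : IsSymbol σ) (f : 𝓢(E n, ℂ)) :
    AEStronglyMeasurable (pdo σ f) volume := by
  have hf := (𝓕 f).continuous
  refine AEStronglyMeasurable.integral_prod_right' (f := fun z : E n × E n => σ z.1 z.2 *
    Complex.exp (2 * (Real.pi : ℂ) * Complex.I * ((inner ℝ z.2 z.1 : ℝ) : ℂ)) * 𝓕 f z.2) ?_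
  refine (hσ.measurable.mul (Continuous.aestronglyMeasurable (by fun_prop))).mul
    (Continuous.aestronglyMeasurable (by fun_prop))

lemma pdo_add {n : ℕ} {σ : E n → E n → ℂ} (hσ : IsSymbol σ) (f g : 𝓢(E n, ℂ)) :
    pdo σ (f + g : 𝓢(E n, ℂ)) = pdo σ f + pdo σ g := by
  ext x
  simp only [pdo_eq, Pi.add_apply]
  rw [← integral_add ((hσ.meanZero x).integrable_mul_schwartz _)
    ((hσ.meanZero x).integrable_mul_schwartz _)]
  refine integral_congr_ae (ae_of_all _ fun ξ => ?_)
  have : 𝓕 (transl x (f + g)) = 𝓕 (transl x f) + 𝓕 (transl x g) := by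
    rw [transl, map_add, FourierTransform.fourier_add]; rfl
  simp only [this, add_apply, mul_add]

lemma pdo_smul {n : ℕ} (σ : E n → E n → ℂ) (c : ℂ) (f : 𝓢(E n, ℂ)) :
    pdo σ (c • f : 𝓢(E n, ℂ)) = c • pdo σ f := by
  ext x
  simp only [pdo_eq, Pi.smul_apply]
  rw [← integral_smul]
  refine integral_congr_ae (ae_of_all _ fun ξ => ?_)
  have : 𝓕 (transl x (c • f)) = c • 𝓕 (transl x f) := by
    rw [transl, map_smul, FourierTransform.fourier_smul]; rfl
  simp only [this, smul_apply, smul_eq_mul]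
  ring

/-- Extension of `T_σ` to `L²`. -/
lemma exists_extension {n : ℕ} {χ : E n → ℝ} (hχ : IsCutoff χ) {σ : E n → E n → ℂ}
    (hσ : IsSymbol σ) (hfin : besovSup χ σ < ⊤) :
    ∃ T : Lp ℂ 2 (volume : Measure (E n)) →L[ℂ] Lp ℂ 2 (volume : Measure (E n)),
      ∀ f : 𝓢(E n, ℂ), (T (f.toLp 2) : E n → ℂ) =ᵐ[volume] pdo σ f := by
  have hB : besovConst hχ * besovSup χ σ ≠ ⊤ := ENNReal.mul_ne_top ENNReal.coe_ne_top hfin.ne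
  have hmem (f : 𝓢(E n, ℂ)) : MemLp (pdo σ f) 2 volume :=
    ⟨aestronglyMeasurable_pdo hσ f, (eLpNorm_pdo_le_besovConst hχ hσ f).trans_lt
      (ENNReal.mul_lt_top hB.lt_top (f.eLpNorm_lt_top _ _))⟩
  let S : 𝓢(E n, ℂ) →ₗ[ℂ] Lp ℂ 2 (volume : Measure (E n)) :=
    { toFun := fun f => (hmem f).toLp
      map_add' := fun f g => by
        rw [← MemLp.toLp_add]
        exact MemLp.toLp_congr _ _ (by rw [pdo_add hσ])
      map_smul' := fun c f => by
        rw [RingHom.id_apply, ← MemLp.toLp_const_smul]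
        exact MemLp.toLp_congr _ _ (by rw [pdo_smul]) }
  let e : 𝓢(E n, ℂ) →ₗ[ℂ] Lp ℂ 2 (volume : Measure (E n)) :=
    (SchwartzMap.toLpCLM ℂ ℂ 2 (volume : Measure (E n))).toLinearMap
  have hdense : DenseRange e := SchwartzMap.denseRange_toLpCLM ENNReal.ofNat_ne_top
  have hbound : ∀ f, ‖S f‖ ≤ (besovConst hχ * besovSup χ σ).toReal * ‖e f‖ := by
    intro f
    have h1 : ‖S f‖ = (eLpNorm (pdo σ f) 2 volume).toReal := Lp.norm_toLp _ (hmem f)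
    have h2 : ‖e f‖ = (eLpNorm f 2 volume).toReal := SchwartzMap.norm_toLp
    rw [h1, h2, ← ENNReal.toReal_mul]
    exact ENNReal.toReal_mono (ENNReal.mul_ne_top hB (f.eLpNorm_lt_top _ _).ne)
      (eLpNorm_pdo_le_besovConst hχ hσ f)
  refine ⟨S.extendOfNorm e, fun f => ?_⟩
  have := LinearMap.extendOfNorm_eq hdense ⟨_, hbound⟩ f
  have he : e f = f.toLp 2 := rfl
  have hS : S f = (hmem f).toLp := rfl
  rw [he, hS] at this
  rw [this]
  exact (hmem f).coeFn_toLp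

/-! ### Littlewood-Paley pieces of lacunary sums. -/

lemma norm_two_zpow_mul {n : ℕ} (l : ℤ) : ‖(2 : ℂ) ^ (l * (n : ℤ))‖ = (2 : ℝ) ^ (l * (n : ℤ)) := by
  rw [norm_zpow, Complex.norm_ofNat]

/-- After rescaling, the fixed factor is the annular function, supported away from `0`, and only the
other factor depends on `l`; both decay lemmas for products then apply. -/
lemma lpProj_schwartz {n : ℕ} {χ : E n → ℝ} (hχ : IsCutoff χ) (l : ℤ) (u : 𝓢(E n, ℂ)) (ξ : E n) :
    lpProj χ l u ξ = (2 : ℂ) ^ (l * (n : ℤ)) *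
      𝓕 (mulS (annS hχ) (dil l (𝓕⁻ u))) (((2 : ℝ) ^ l) • ξ) := by
  have h := lpProj_fourier hχ l (𝓕⁻ u) ξ
  rw [FourierTransform.fourier_fourierInv_eq] at h
  rw [h, mulS_dil_eq, fourier_dil, neg_neg]

/-- Almost orthogonality estimate for the pieces of a Schwartz function. -/
lemma exists_lpProj_decay {n : ℕ} (hn : 1 ≤ n) {χ : E n → ℝ} (hχ : IsCutoff χ) (u : 𝓢(E n, ℂ)) :
    ∃ C : ℝ, 0 ≤ C ∧ ∀ (l : ℤ) (ξ : E n),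
      (1 + (2 : ℝ) ^ l * ‖ξ‖) ^ (n + 1) * ‖lpProj χ l u ξ‖ ≤ C * (1 / 2) ^ l.natAbs := by
  obtain ⟨C, hC, hc⟩ := exists_fourier_mulS_dil_decay (annS hχ) (𝓕⁻ u) (n + 1)
  obtain ⟨D, hD, hd⟩ := exists_fourier_mulS_dil_decay_of_nonneg (annS hχ) (𝓕⁻ u) (n + 1) (n + 1)
    fun y hy => by rw [annS_apply, annular_eq_zero_of_lt hχ hy]
  refine ⟨C + D, by positivity, fun l ξ => ?_⟩
  have hs : ‖((2 : ℝ) ^ l) • ξ‖ = (2 : ℝ) ^ l * ‖ξ‖ := by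
    rw [norm_smul, Real.norm_of_nonneg (by positivity)]
  rw [lpProj_schwartz hχ, norm_mul, norm_two_zpow_mul, ← hs, mul_left_comm]
  -- For `l ≥ 0` the choice `M = n + 1` beats the prefactor `2^{ln}` by `2^{-l}`. For `l ≤ 0` the
  -- prefactor itself is at most `2^l`, because `n ≥ 1`.
  rcases le_total 0 l with hl | hl
  · obtain ⟨j, rfl⟩ := Int.eq_ofNat_of_zero_le hl
    calc _ ≤ (2 : ℝ) ^ ((j : ℤ) * n) * (D * ((2 : ℝ) ^ (j * (n + 1)))⁻¹) := by
          exact mul_le_mul_of_nonneg_left (hd j _) (by positivity)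
      _ = D * (1 / 2) ^ j := by
          rw [show ((j : ℤ) * n) = ((j * n : ℕ) : ℤ) by push_cast; ring, zpow_natCast, mul_add,
            mul_one, pow_add, one_div, inv_pow]
          field_simp
      _ ≤ _ := by
          rw [Int.natAbs_natCast]
          gcongr
          linarith
  · obtain ⟨j, rfl⟩ := Int.exists_eq_neg_ofNat hl
    calc _ ≤ (2 : ℝ) ^ (-(j : ℤ) * n) * C := by
          exact mul_le_mul_of_nonneg_left (hc _ hl _) (by positivity)
      _ ≤ (1 / 2) ^ j * C := by
          gcongr
          rw [one_div, inv_pow, ← zpow_natCast, ← zpow_neg]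
          refine zpow_le_zpow_right₀ one_le_two ?_
          have : (1 : ℤ) ≤ n := by exact_mod_cast hn
          nlinarith
      _ ≤ _ := by
          rw [Int.natAbs_neg, Int.natAbs_natCast, mul_comm]
          gcongr
          linarith

lemma lpProj_dil {n : ℕ} (χ : E n → ℝ) (l k : ℤ) (u : 𝓢(E n, ℂ)) (ξ : E n) :
    lpProj χ l (dil k u) ξ = lpProj χ (l - k) u (((2 : ℝ) ^ k) • ξ) := by
  rw [lpProj, lpProj]
  have h := Measure.integral_comp_smul_of_nonneg (volume : Measure (E n)) (fun η : E n =>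
    𝓕 (annular χ) (((2 : ℝ) ^ (l - k)) • (((2 : ℝ) ^ k) • ξ - η)) * u η) ((2 : ℝ) ^ k)
    (hR := by positivity)
  have h1 (η : E n) : 𝓕 (annular χ) (((2 : ℝ) ^ (l - k)) • (((2 : ℝ) ^ k) • ξ - ((2 : ℝ) ^ k) • η))
      * u (((2 : ℝ) ^ k) • η) = 𝓕 (annular χ) (((2 : ℝ) ^ l) • (ξ - η)) * dil k u η := by
    rw [← smul_sub, smul_smul, ← zpow_add₀ two_ne_zero, sub_add_cancel, dil_apply]
  simp only [h1] at h
  rw [h, Complex.real_smul, ← mul_assoc]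
  congr 1
  simp only [finrank_euclideanSpace, Fintype.card_fin]
  push_cast
  rw [sub_mul, zpow_sub₀ two_ne_zero, zpow_mul _ k, zpow_natCast, div_eq_mul_inv]

lemma exists_lpProj_dil_decay {n : ℕ} (hn : 1 ≤ n) {χ : E n → ℝ} (hχ : IsCutoff χ)
    (u : 𝓢(E n, ℂ)) : ∃ C : ℝ, 0 ≤ C ∧ ∀ (l k : ℤ) (ξ : E n),
      ‖lpProj χ l (dil k u) ξ‖ ≤
        C * (1 / 2) ^ (l - k).natAbs * ((1 + (2 : ℝ) ^ l * ‖ξ‖) ^ (n + 1))⁻¹ := by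
  obtain ⟨C, hC, hc⟩ := exists_lpProj_decay hn hχ u
  refine ⟨C, hC, fun l k ξ => ?_⟩
  have := hc (l - k) (((2 : ℝ) ^ k) • ξ)
  rw [norm_smul, Real.norm_of_nonneg (by positivity), ← mul_assoc, ← zpow_add₀ two_ne_zero,
    sub_add_cancel] at this
  rwa [lpProj_dil, ← div_eq_mul_inv, le_div_iff₀' (by positivity)]

/-- Lacunary superposition of dyadic dilates. -/
def lacunary {n : ℕ} (a : ℕ → ℂ) (u : 𝓢(E n, ℂ)) (ξ : E n) : ℂ := ∑' k : ℕ, a k * dil k u ξ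

lemma integral_norm_dil {n : ℕ} (k : ℕ) (u : 𝓢(E n, ℂ)) :
    ∫ η, ‖dil k u η‖ = ((2 : ℝ) ^ (k * n))⁻¹ * ∫ η, ‖u η‖ := by
  have := Measure.integral_comp_smul_of_nonneg (volume : Measure (E n)) (fun η : E n => ‖u η‖)
    ((2 : ℝ) ^ k) (hR := by positivity)
  simpa only [dil_apply, zpow_natCast, finrank_euclideanSpace, Fintype.card_fin, smul_eq_mul,
    ← pow_mul] using this

/-- Sum and integral may be exchanged because the `L¹` norms of the dilates decay like `2^{-kn}`,
which is summable for `n ≥ 1`. -/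
lemma lpProj_lacunary {n : ℕ} (hn : 1 ≤ n) {χ : E n → ℝ} (hχ : IsCutoff χ) {a : ℕ → ℂ}
    (ha : ∀ k, ‖a k‖ ≤ 1) (u : 𝓢(E n, ℂ)) (l : ℤ) (ξ : E n) :
    HasSum (fun k : ℕ => a k * lpProj χ l (dil k u) ξ) (lpProj χ l (lacunary a u) ξ) := by
  obtain ⟨B, hB, hb⟩ := exists_schwartz_decay (dil l (𝓕 (annS hχ))) 0
  have hker (η : E n) : ‖dil l (𝓕 (annS hχ)) (ξ - η)‖ ≤ B := by simpa using hb (ξ - η)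
  have hcont : Continuous fun η => dil l (𝓕 (annS hχ)) (ξ - η) :=
    (dil l (𝓕 (annS hχ))).continuous.comp (continuous_const.sub continuous_id)
  set F : ℕ → E n → ℂ := fun k η => dil l (𝓕 (annS hχ)) (ξ - η) * (a k * dil k u η) with hF
  have hle (k : ℕ) (η : E n) : ‖F k η‖ ≤ B * ‖dil k u η‖ := by
    rw [hF, norm_mul, norm_mul]
    gcongr
    · exact hker η
    · exact mul_le_of_le_one_left (norm_nonneg _) (ha k)
  have hint (k : ℕ) : Integrable (F k) :=
    ((dil k u).integrable.norm.const_mul B).mono'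
      (hcont.mul (continuous_const.mul (dil k u).continuous)).aestronglyMeasurable
      (ae_of_all _ (hle k))
  have hsum : Summable fun k => ∫ η, ‖F k η‖ := by
    refine Summable.of_nonneg_of_le (fun k => integral_nonneg fun _ => norm_nonneg _) (fun k => ?_)
      (summable_geometric_two.mul_right (B * ∫ η, ‖u η‖))
    calc ∫ η, ‖F k η‖ ≤ ∫ η, B * ‖dil k u η‖ :=
          integral_mono (hint k).norm ((dil k u).integrable.norm.const_mul B) (hle k)
      _ = ((2 : ℝ) ^ (k * n))⁻¹ * (B * ∫ η, ‖u η‖) := by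
          rw [integral_const_mul, integral_norm_dil]; ring
      _ ≤ _ := by
          have : 0 ≤ ∫ η, ‖u η‖ := integral_nonneg fun _ => norm_nonneg _
          rw [one_div, inv_pow]
          gcongr
          · exact one_le_two
          · exact Nat.le_mul_of_pos_right k hn
  have h := (hasSum_integral_of_summable_integral_norm hint hsum).mul_left ((2 : ℂ) ^ (l * (n : ℤ)))
  have h1 (k : ℕ) : (2 : ℂ) ^ (l * (n : ℤ)) * ∫ η, F k η = a k * lpProj χ l (dil k u) ξ := by
    rw [lpProj_eq hχ, mul_left_comm, ← integral_const_mul (a k)]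
    congr 2 with η
    simp only [hF]
    ring
  have h2 : (2 : ℂ) ^ (l * (n : ℤ)) * ∫ η, ∑' k, F k η = lpProj χ l (lacunary a u) ξ := by
    rw [lpProj_eq hχ]
    congr 2 with η
    rw [hF, tsum_mul_left, lacunary]
  rw [h2] at h
  simpa only [h1] using h

/-- The slowly varying coefficients `(k + 1)^{-1/2}`. -/
def coef (k : ℕ) : ℝ := (√((k : ℝ) + 1))⁻¹

lemma coef_pos (k : ℕ) : 0 < coef k := by
  unfold coef; positivity

lemma coef_sq (k : ℕ) : coef k ^ 2 = ((k : ℝ) + 1)⁻¹ := by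
  rw [coef, inv_pow, Real.sq_sqrt (by positivity)]

lemma coef_le_one (k : ℕ) : coef k ≤ 1 := by
  refine inv_le_one_of_one_le₀ ?_
  rw [Real.one_le_sqrt]
  linarith [(Nat.cast_nonneg k : (0 : ℝ) ≤ k)]

/-- Replacing one coefficient by another costs only a factor linear in the distance of the indices;
geometric off-diagonal decay absorbs it, whence the form of `wt`. -/
lemma coef_sq_le (k l : ℕ) : coef k ^ 2 ≤ coef l ^ 2 * (1 + ((l : ℤ) - k).natAbs) := by
  rw [coef_sq, coef_sq, inv_mul_eq_div, le_div_iff₀ (by positivity), inv_mul_le_iff₀ (by positivity)]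
  have h : (l : ℝ) ≤ k + ((l : ℤ) - k).natAbs := by
    exact_mod_cast (by omega : l ≤ k + ((l : ℤ) - k).natAbs)
  nlinarith [(Nat.cast_nonneg k : (0 : ℝ) ≤ k),
    (Nat.cast_nonneg ((l : ℤ) - k).natAbs : (0 : ℝ) ≤ ((l : ℤ) - k).natAbs)]

lemma coef_le (k l : ℕ) : coef k ≤ coef l * (1 + ((l : ℤ) - k).natAbs) := by
  have hk := coef_pos k
  have hl := coef_pos l
  have h := coef_sq_le k l
  have hj : (0 : ℝ) ≤ ((l : ℤ) - k).natAbs := Nat.cast_nonneg _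
  refine le_of_sq_le_sq ?_ (by positivity)
  nlinarith [sq_nonneg (coef l), mul_nonneg (sq_nonneg (coef l)) hj,
    mul_nonneg (mul_nonneg (sq_nonneg (coef l)) hj) hj]

/-- A two-sided convergent weight. -/
def wt (θ : ℝ) (j : ℤ) : ℝ := (1 + j.natAbs) * θ ^ j.natAbs

lemma wt_nonneg {θ : ℝ} (hθ : 0 ≤ θ) (j : ℤ) : 0 ≤ wt θ j := by unfold wt; positivity

lemma summable_wt {θ : ℝ} (hθ : 0 ≤ θ) (hθ1 : θ < 1) : Summable (wt θ) := by
  have h : Summable fun m : ℕ => (1 + (m : ℝ)) * θ ^ m := by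
    have h1 := summable_pow_mul_geometric_of_norm_lt_one 1
      (r := θ) (by rwa [Real.norm_of_nonneg hθ])
    have h0 := summable_geometric_of_lt_one hθ hθ1
    refine (h0.add h1).congr fun m => ?_
    ring
  refine Summable.of_nat_of_neg ?_ ?_ <;> simpa [wt] using h

lemma summable_wt_sub {θ : ℝ} (hθ : 0 ≤ θ) (hθ1 : θ < 1) (l : ℤ) :
    Summable fun k : ℕ => wt θ (l - k) :=
  (summable_wt hθ hθ1).comp_injective (i := fun k : ℕ => l - (k : ℤ)) fun a b h => by simpa using h

lemma tsum_wt_sub_le {θ : ℝ} (hθ : 0 ≤ θ) (hθ1 : θ < 1) (l : ℤ) :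
    ∑' k : ℕ, wt θ (l - k) ≤ ∑' j : ℤ, wt θ j :=
  tsum_comp_le_tsum_of_inj (summable_wt hθ hθ1) (fun j => wt_nonneg hθ j)
    (i := fun k : ℕ => l - (k : ℤ)) fun a b h => by simpa using h

/-- The pieces of a lacunary superposition have the size of the coefficients. -/
lemma exists_lpProj_lacunary_decay {n : ℕ} (hn : 1 ≤ n) {χ : E n → ℝ} (hχ : IsCutoff χ)
    (u : 𝓢(E n, ℂ)) : ∃ C : ℝ, 0 ≤ C ∧ ∀ a : ℕ → ℂ, (∀ k, ‖a k‖ ≤ coef k) →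
      ∀ (l : ℕ) (ξ : E n), ‖lpProj χ l (lacunary a u) ξ‖ ≤
        C * coef l * ((1 + (2 : ℝ) ^ l * ‖ξ‖) ^ (n + 1))⁻¹ := by
  obtain ⟨C, hC, hc⟩ := exists_lpProj_dil_decay hn hχ u
  refine ⟨C * ∑' j : ℤ, wt (1 / 2) j,
    mul_nonneg hC (tsum_nonneg fun j => wt_nonneg (by norm_num) j), fun a ha l ξ => ?_⟩
  set W := ((1 + (2 : ℝ) ^ l * ‖ξ‖) ^ (n + 1))⁻¹ with hW
  have hW0 : 0 ≤ W := by positivity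
  have h1 (k : ℕ) : ‖a k * lpProj χ l (dil k u) ξ‖ ≤ C * coef l * W * wt (1 / 2) ((l : ℤ) - k) := by
    rw [norm_mul]
    have := hc l k ξ
    rw [zpow_natCast, ← hW] at this
    calc _ ≤ (coef l * (1 + ((l : ℤ) - k).natAbs)) *
          (C * (1 / 2) ^ ((l : ℤ) - k).natAbs * W) := by
          have := coef_pos l
          gcongr
          exact (ha k).trans (coef_le k l)
      _ = _ := by rw [wt]; ring
  have hs := (summable_wt_sub (θ := 1 / 2) (by norm_num) (by norm_num) l)
  rw [← (lpProj_lacunary hn hχ (fun k => (ha k).trans (coef_le_one k)) u l ξ).tsum_eq]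
  refine (tsum_of_norm_bounded (hs.mul_left _).hasSum h1).trans ?_
  rw [tsum_mul_left]
  have h2 := tsum_wt_sub_le (θ := 1 / 2) (by norm_num) (by norm_num) l
  have := coef_pos l
  calc _ ≤ C * coef l * W * ∑' j : ℤ, wt (1 / 2) j := by gcongr
    _ = _ := by ring

/-! ### The square function and the Sobolev norm. -/

/-- The square of the Littlewood-Paley square function of `sobolevNorm`. -/
def sqFun {n : ℕ} (χ : E n → ℝ) (s : ℝ) (f : E n → ℂ) (ξ : E n) : ℝ≥0∞ :=
  ∑' l : ℕ, (2 : ℝ≥0∞) ^ (2 * (l : ℝ) * s) * ‖lpProj χ (l : ℤ) f ξ‖ₑ ^ 2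

/-- The pointwise size of the square function of a lacunary superposition. -/
def sqTerm (n : ℕ) (s r : ℝ) (l : ℕ) : ℝ :=
  2 ^ (2 * (l : ℝ) * s) * (coef l ^ 2 * (((1 + (2 : ℝ) ^ l * r) ^ (n + 1))⁻¹) ^ 2)

lemma sqFun_le {n : ℕ} {χ : E n → ℝ} {s C : ℝ} {f : E n → ℂ} {ξ : E n}
    (h : ∀ l : ℕ, ‖lpProj χ l f ξ‖ ≤ C * coef l * ((1 + (2 : ℝ) ^ l * ‖ξ‖) ^ (n + 1))⁻¹) :
    sqFun χ s f ξ ≤ ENNReal.ofReal (C ^ 2) * ∑' l : ℕ, ENNReal.ofReal (sqTerm n s ‖ξ‖ l) := by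
  rw [sqFun, ← ENNReal.tsum_mul_left]
  refine ENNReal.tsum_le_tsum fun l => ?_
  have h2 : (2 : ℝ≥0∞) ^ (2 * (l : ℝ) * s) = ENNReal.ofReal (2 ^ (2 * (l : ℝ) * s)) := by
    rw [← ENNReal.ofReal_rpow_of_pos two_pos, ENNReal.ofReal_ofNat]
  rw [h2, ← ofReal_norm, ← ENNReal.ofReal_pow (norm_nonneg _),
    ← ENNReal.ofReal_mul (by positivity), ← ENNReal.ofReal_mul (by positivity)]
  refine ENNReal.ofReal_le_ofReal ?_
  have := pow_le_pow_left₀ (norm_nonneg _) (h l) 2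
  calc _ ≤ (2 : ℝ) ^ (2 * (l : ℝ) * s) *
        (C * coef l * ((1 + (2 : ℝ) ^ l * ‖ξ‖) ^ (n + 1))⁻¹) ^ 2 := by gcongr
    _ = _ := by rw [sqTerm]; ring

lemma inv_pow_sq_le {n l : ℕ} {r b : ℝ} (hr : 0 ≤ r) (hb : 0 < b) (h : b ≤ 2 * (2 ^ l * r)) :
    (((1 + (2 : ℝ) ^ l * r) ^ (n + 1))⁻¹) ^ 2 ≤ 4 ^ (n + 1) * ((b ^ (n + 1))⁻¹) ^ 2 := by
  have h1 : b ^ (n + 1) ≤ 2 ^ (n + 1) * (1 + (2 : ℝ) ^ l * r) ^ (n + 1) := by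
    rw [← mul_pow]
    have : 0 ≤ (2 : ℝ) ^ l * r := by positivity
    gcongr
    linarith
  have h2 : ((1 + (2 : ℝ) ^ l * r) ^ (n + 1))⁻¹ ≤ 2 ^ (n + 1) * (b ^ (n + 1))⁻¹ := by
    rw [← div_eq_mul_inv, le_div_iff₀ (by positivity), inv_mul_le_iff₀ (by positivity), mul_comm]
    exact h1
  calc _ ≤ (2 ^ (n + 1) * (b ^ (n + 1))⁻¹) ^ 2 := by gcongr
    _ = _ := by
      rw [mul_pow, ← pow_mul, mul_comm (n + 1) 2, pow_mul]
      norm_num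

lemma two_rpow_le {n j : ℕ} {s : ℝ} (hs : 2 * s ≤ n) :
    (2 : ℝ) ^ (2 * (j : ℝ) * s) ≤ 2 ^ (j * n) := by
  rw [← Real.rpow_natCast]
  refine Real.rpow_le_rpow_of_exponent_le one_le_two ?_
  push_cast
  nlinarith [(Nat.cast_nonneg j : (0 : ℝ) ≤ j)]

lemma two_pow_mul_inv_le (n j : ℕ) :
    (2 : ℝ) ^ (j * n) * ((((2 : ℝ) ^ j) ^ (n + 1))⁻¹) ^ 2 ≤ (1 / 2) ^ j := by
  have : (2 : ℝ) ^ (j * n) * ((((2 : ℝ) ^ j) ^ (n + 1))⁻¹) ^ 2 =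
      (1 / 2) ^ j * (1 / 2) ^ (j * (n + 1)) := by
    simp only [← pow_mul, mul_add, mul_one, pow_add, one_div, inv_pow]
    field_simp
  rw [this]
  exact mul_le_of_le_one_right (by positivity) (pow_le_one₀ (by norm_num) (by norm_num))

/-- The ratio of the geometric bounds of the square function. -/
def ratio (s : ℝ) : ℝ := max ((2 : ℝ) ^ (-(2 * s))) (1 / 2)

lemma ratio_nonneg (s : ℝ) : 0 ≤ ratio s := le_max_of_le_right (by norm_num)

lemma ratio_lt_one {s : ℝ} (hs : 0 < s) : ratio s < 1 :=
  max_lt (Real.rpow_lt_one_of_one_lt_of_neg one_lt_two (by linarith)) (by norm_num)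

/-- The scale `l = m` dominates. Below it `2^{2ls}` decreases geometrically with ratio `2^{-2s}`;
above it the factor `(2^l r)^{-2(n+1)}` beats `2^{2ls} ≤ 2^{ln}` and leaves ratio `1/2`. -/
lemma sqTerm_le_of_inner {n : ℕ} {s r : ℝ} (hs : 2 * s ≤ n) {m : ℕ} (hr : 1 / 2 ≤ 2 ^ m * r)
    (l : ℕ) :
    sqTerm n s r l ≤
      4 ^ (2 * (n + 1)) * (coef m ^ 2 * 2 ^ (2 * (m : ℝ) * s)) * wt (ratio s) ((m : ℤ) - l) := by
  have hr0 : 0 ≤ r := by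
    by_contra h
    have : (2 : ℝ) ^ m * r < 0 := mul_neg_of_pos_of_neg (by positivity) (not_le.1 h)
    linarith
  have hmain : (2 : ℝ) ^ (2 * (l : ℝ) * s) * (((1 + (2 : ℝ) ^ l * r) ^ (n + 1))⁻¹) ^ 2 ≤
      4 ^ (2 * (n + 1)) * 2 ^ (2 * (m : ℝ) * s) * ratio s ^ ((m : ℤ) - l).natAbs := by
    rcases le_total l m with hl | hl
    · obtain ⟨j, rfl⟩ := Nat.exists_eq_add_of_le hl
      have hj : (((l + j : ℕ) : ℤ) - l).natAbs = j := by omega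
      rw [hj]
      have h1 : (2 : ℝ) ^ (2 * (l : ℝ) * s) =
          2 ^ (2 * ((l + j : ℕ) : ℝ) * s) * ((2 : ℝ) ^ (-(2 * s))) ^ j := by
        rw [← Real.rpow_natCast (_ ^ _) j, ← Real.rpow_mul two_pos.le, ← Real.rpow_add two_pos]
        congr 1
        push_cast
        ring
      have h2 : (((1 + (2 : ℝ) ^ l * r) ^ (n + 1))⁻¹) ^ 2 ≤ 1 := by
        refine pow_le_one₀ (by positivity) (inv_le_one_of_one_le₀ (one_le_pow₀ ?_))
        have : 0 ≤ (2 : ℝ) ^ l * r := by positivity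
        linarith
      calc _ ≤ (2 : ℝ) ^ (2 * (l : ℝ) * s) * 1 := by gcongr
        _ = 1 * 2 ^ (2 * ((l + j : ℕ) : ℝ) * s) * ((2 : ℝ) ^ (-(2 * s))) ^ j := by
          rw [h1]; ring
        _ ≤ _ := by
          gcongr
          · exact one_le_pow₀ (by norm_num)
          · exact le_max_left _ _
    · obtain ⟨j, rfl⟩ := Nat.exists_eq_add_of_le hl
      have hj : ((m : ℤ) - (m + j : ℕ)).natAbs = j := by omega
      rw [hj]
      have h1 : (2 : ℝ) ^ (2 * ((m + j : ℕ) : ℝ) * s) =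
          2 ^ (2 * (m : ℝ) * s) * 2 ^ (2 * (j : ℝ) * s) := by
        rw [← Real.rpow_add two_pos]
        congr 1
        push_cast
        ring
      have h2 := inv_pow_sq_le (n := n) (l := m + j) hr0 (b := 2 ^ j) (by positivity) (by
        rw [pow_add]
        nlinarith [show (0 : ℝ) < 2 ^ j by positivity])
      calc _ ≤ (2 ^ (2 * (m : ℝ) * s) * 2 ^ (j * n)) *
            (4 ^ (n + 1) * ((((2 : ℝ) ^ j) ^ (n + 1))⁻¹) ^ 2) := by
            rw [h1]
            gcongr
            exact two_rpow_le hs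
        _ = 4 ^ (n + 1) * 2 ^ (2 * (m : ℝ) * s) *
            (2 ^ (j * n) * ((((2 : ℝ) ^ j) ^ (n + 1))⁻¹) ^ 2) := by ring
        _ ≤ 4 ^ (n + 1) * 2 ^ (2 * (m : ℝ) * s) * (1 / 2) ^ j := by
            gcongr
            exact two_pow_mul_inv_le n j
        _ ≤ _ := by
            gcongr
            · norm_num
            · omega
            · exact le_max_right _ _
  calc sqTerm n s r l = coef l ^ 2 * ((2 : ℝ) ^ (2 * (l : ℝ) * s) *
        (((1 + (2 : ℝ) ^ l * r) ^ (n + 1))⁻¹) ^ 2) := by rw [sqTerm]; ring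
    _ ≤ (coef m ^ 2 * (1 + ((m : ℤ) - l).natAbs)) * (4 ^ (2 * (n + 1)) *
        2 ^ (2 * (m : ℝ) * s) * ratio s ^ ((m : ℤ) - l).natAbs) := by
        gcongr
        exact coef_sq_le l m
    _ = _ := by rw [wt]; ring

lemma sqTerm_le_of_outer {n : ℕ} {s r : ℝ} (hs : 2 * s ≤ n) (hr : 1 ≤ r) (l : ℕ) :
    sqTerm n s r l ≤ 4 ^ (n + 1) * (((1 + r) ^ (n + 1))⁻¹) ^ 2 * (1 / 2) ^ l := by
  have h2 := inv_pow_sq_le (n := n) (l := l) (r := r) (by linarith) (b := 2 ^ l * (1 + r))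
    (by positivity) (by nlinarith [show (0 : ℝ) < 2 ^ l by positivity])
  have h3 : coef l ^ 2 ≤ 1 := pow_le_one₀ (coef_pos l).le (coef_le_one l)
  calc sqTerm n s r l ≤ 2 ^ (l * n) * (1 * (4 ^ (n + 1) * (((2 ^ l * (1 + r)) ^ (n + 1))⁻¹) ^ 2)) := by
        rw [sqTerm]
        gcongr
        exact two_rpow_le hs
    _ = 4 ^ (n + 1) * (((1 + r) ^ (n + 1))⁻¹) ^ 2 *
        (2 ^ (l * n) * ((((2 : ℝ) ^ l) ^ (n + 1))⁻¹) ^ 2) := by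
        rw [mul_pow, mul_inv, mul_pow]; ring
    _ ≤ _ := by
        gcongr
        exact two_pow_mul_inv_le n l

lemma tsum_ofReal_le {f g : ℕ → ℝ} (hg : Summable g) (hg0 : ∀ l, 0 ≤ g l) (h : ∀ l, f l ≤ g l) :
    ∑' l, ENNReal.ofReal (f l) ≤ ENNReal.ofReal (∑' l, g l) := by
  rw [ENNReal.ofReal_tsum_of_nonneg hg0 hg]
  exact ENNReal.tsum_le_tsum fun l => ENNReal.ofReal_le_ofReal (h l)

lemma tsum_sqTerm_le_of_inner {n : ℕ} {s r : ℝ} (hs0 : 0 < s) (hs : 2 * s ≤ n) {m : ℕ}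
    (hr : 1 / 2 ≤ 2 ^ m * r) :
    ∑' l, ENNReal.ofReal (sqTerm n s r l) ≤ ENNReal.ofReal
      (4 ^ (2 * (n + 1)) * (∑' j, wt (ratio s) j) * (coef m ^ 2 * 2 ^ (2 * (m : ℝ) * s))) := by
  have hw := summable_wt_sub (ratio_nonneg s) (ratio_lt_one hs0) m
  refine (tsum_ofReal_le (hw.mul_left _) (fun l => mul_nonneg (by positivity)
    (wt_nonneg (ratio_nonneg s) _)) (sqTerm_le_of_inner hs hr)).trans
    (ENNReal.ofReal_le_ofReal ?_)
  rw [tsum_mul_left, mul_right_comm]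
  have := tsum_wt_sub_le (ratio_nonneg s) (ratio_lt_one hs0) m
  calc _ ≤ 4 ^ (2 * (n + 1)) * (∑' j, wt (ratio s) j) * (coef m ^ 2 * 2 ^ (2 * (m : ℝ) * s)) := by
        gcongr
    _ = _ := by ring

lemma tsum_sqTerm_le_of_outer {n : ℕ} {s r : ℝ} (hs : 2 * s ≤ n) (hr : 1 ≤ r) :
    ∑' l, ENNReal.ofReal (sqTerm n s r l) ≤
      ENNReal.ofReal (4 ^ (n + 1) * (((1 + r) ^ (n + 1))⁻¹) ^ 2 * 2) := by
  refine (tsum_ofReal_le (summable_geometric_two.mul_left _) (fun l => by positivity)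
    (sqTerm_le_of_outer hs hr)).trans_eq ?_
  rw [tsum_mul_left, tsum_geometric_two]

lemma exists_dyadic_shell {r : ℝ} (hr : 0 < r) (hr1 : r < 1) :
    ∃ m : ℕ, 1 / 2 ≤ 2 ^ m * r ∧ r ≤ ((2 : ℝ) ^ m)⁻¹ := by
  obtain ⟨m, h1, h2⟩ := exists_nat_pow_near (one_le_inv₀ hr |>.2 hr1.le) (one_lt_two (α := ℝ))
  refine ⟨m, ?_, (le_inv_comm₀ hr (by positivity)).2 h1⟩
  rw [pow_succ, inv_lt_iff_one_lt_mul₀ hr] at h2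
  linarith

/-- A majorant of `sqFun ^ (p / 2)`. -/
def sqMajorant (n : ℕ) (p s C : ℝ) (ξ : E n) : ℝ≥0∞ :=
  (∑' m : ℕ, (Metric.closedBall (0 : E n) ((2 : ℝ) ^ m)⁻¹).indicator (fun _ => ENNReal.ofReal
      ((C * (4 ^ (2 * (n + 1)) * (∑' j, wt (ratio s) j) * (coef m ^ 2 * 2 ^ (2 * (m : ℝ) * s))))
        ^ (p / 2))) ξ) +
    ENNReal.ofReal ((C * (4 ^ (n + 1) * (((1 + ‖ξ‖) ^ (n + 1))⁻¹) ^ 2 * 2)) ^ (p / 2))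

lemma tsum_wt_nonneg (s : ℝ) : 0 ≤ ∑' j, wt (ratio s) j :=
  tsum_nonneg fun j => wt_nonneg (ratio_nonneg s) j

lemma ofReal_mul_tsum_sqTerm_le {n : ℕ} {p s C : ℝ} (hp : 0 < p) (hs0 : 0 < s) (hs : 2 * s ≤ n)
    (hC : 0 ≤ C) {ξ : E n} (hξ : ξ ≠ 0) :
    (ENNReal.ofReal C * ∑' l : ℕ, ENNReal.ofReal (sqTerm n s ‖ξ‖ l)) ^ (p / 2) ≤
      sqMajorant n p s C ξ := by
  have hw := tsum_wt_nonneg s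
  rcases lt_or_ge ‖ξ‖ 1 with h | h
  · obtain ⟨m, hm1, hm2⟩ := exists_dyadic_shell (norm_pos_iff.2 hξ) h
    refine le_trans ?_ (le_add_right (ENNReal.le_tsum m))
    rw [Set.indicator_of_mem (by simpa using hm2), ← ENNReal.ofReal_rpow_of_nonneg (by positivity)
      (by positivity), ENNReal.ofReal_mul hC]
    gcongr
    exact tsum_sqTerm_le_of_inner hs0 hs hm1
  · refine le_add_left ?_
    rw [← ENNReal.ofReal_rpow_of_nonneg (by positivity) (by positivity), ENNReal.ofReal_mul hC]
    gcongr
    exact tsum_sqTerm_le_of_outer hs h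

lemma volume_closedBall_two_pow (n m : ℕ) :
    volume (Metric.closedBall (0 : E n) ((2 : ℝ) ^ m)⁻¹) =
      ENNReal.ofReal (((2 : ℝ) ^ (m * n))⁻¹) * volume (Metric.ball (0 : E n) 1) := by
  rw [Measure.addHaar_closedBall _ _ (by positivity), finrank_euclideanSpace, Fintype.card_fin,
    inv_pow, ← pow_mul]

/-- With `sp = n` the factor `2^{msp}` cancels the volume `2^{-mn}` of the ball exactly. What
remains is `∑ (m+1)^{-p/2}`, convergent because `p > 2`; the part at infinity is integrable thanks
to the decay of order `(n+1)p > n`. -/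
lemma lintegral_sqMajorant_lt_top {n : ℕ} {p s C : ℝ} (hp : 2 < p) (hsp : s * p = n)
    (hC : 0 ≤ C) : ∫⁻ ξ, sqMajorant n p s C ξ < ⊤ := by
  have hw := tsum_wt_nonneg s
  set B : ℝ := C * (4 ^ (2 * (n + 1)) * (∑' j, wt (ratio s) j)) with hB
  have hB0 : 0 ≤ B := by positivity
  have hmeas : Measurable fun ξ : E n => ∑' m : ℕ,
      (Metric.closedBall (0 : E n) ((2 : ℝ) ^ m)⁻¹).indicator (fun _ => ENNReal.ofReal
      ((C * (4 ^ (2 * (n + 1)) * (∑' j, wt (ratio s) j) * (coef m ^ 2 * 2 ^ (2 * (m : ℝ) * s))))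
        ^ (p / 2))) ξ :=
    Measurable.tsum fun m => measurable_const.indicator measurableSet_closedBall
  simp only [sqMajorant]
  rw [lintegral_add_left hmeas, ENNReal.add_lt_top]
  constructor
  · rw [lintegral_tsum fun m =>
      (measurable_const.indicator measurableSet_closedBall).aemeasurable]
    have hterm (m : ℕ) : ∫⁻ ξ, (Metric.closedBall (0 : E n) ((2 : ℝ) ^ m)⁻¹).indicator
        (fun _ => ENNReal.ofReal ((C * (4 ^ (2 * (n + 1)) * (∑' j, wt (ratio s) j) *
          (coef m ^ 2 * 2 ^ (2 * (m : ℝ) * s)))) ^ (p / 2))) ξ =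
        ENNReal.ofReal (B ^ (p / 2) * ((m + 1 : ℕ) : ℝ) ^ (-(p / 2))) *
          volume (Metric.ball (0 : E n) 1) := by
      rw [lintegral_indicator_const measurableSet_closedBall, volume_closedBall_two_pow,
        ← mul_assoc, ← ENNReal.ofReal_mul (by positivity)]
      congr 2
      rw [← mul_assoc, ← hB, Real.mul_rpow hB0 (by positivity), mul_assoc]
      congr 1
      rw [Real.mul_rpow (by positivity) (by positivity), mul_assoc, coef_sq,
        ← Real.rpow_mul two_pos.le, Real.inv_rpow (by positivity), Real.rpow_neg (by positivity)]
      have : (2 : ℝ) ^ (2 * (m : ℝ) * s * (p / 2)) = 2 ^ (m * n) := by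
        rw [← Real.rpow_natCast]
        congr 1
        push_cast
        rw [← hsp]
        ring
      rw [this, mul_inv_cancel₀ (by positivity), mul_one]
      push_cast
      rfl
    simp only [hterm]
    rw [ENNReal.tsum_mul_right]
    refine ENNReal.mul_lt_top ?_ measure_ball_lt_top
    have hs : Summable fun m : ℕ => B ^ (p / 2) * ((m + 1 : ℕ) : ℝ) ^ (-(p / 2)) :=
      ((summable_nat_add_iff 1).2 (Real.summable_nat_rpow.2 (by linarith))).mul_left _
    exact hs.tsum_ofReal_lt_top
  · set D : ℝ := C * (4 ^ (n + 1) * 2) with hD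
    have hD0 : 0 ≤ D := by positivity
    have hI : Integrable fun ξ : E n => D ^ (p / 2) * (1 + ‖ξ‖) ^ (-(((n : ℝ) + 1) * p)) := by
      refine (integrable_one_add_norm ?_).const_mul _
      rw [finrank_euclideanSpace, Fintype.card_fin]
      nlinarith [(Nat.cast_nonneg n : (0 : ℝ) ≤ n)]
    refine lt_of_eq_of_lt (lintegral_congr fun ξ => ?_) hI.lintegral_lt_top
    congr 1
    rw [show C * (4 ^ (n + 1) * (((1 + ‖ξ‖) ^ (n + 1))⁻¹) ^ 2 * 2) =
      D * (((1 + ‖ξ‖) ^ (n + 1))⁻¹) ^ 2 by rw [hD]; ring, Real.mul_rpow hD0 (by positivity)]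
    congr 1
    rw [← Real.rpow_natCast (1 + ‖ξ‖) (n + 1), ← Real.rpow_neg (by positivity),
      ← Real.rpow_natCast _ 2, ← Real.rpow_mul (by positivity), ← Real.rpow_mul (by positivity)]
    congr 1
    push_cast
    ring

/-- Uniform Sobolev bound for lacunary superpositions. -/
lemma exists_sobolevNorm_lacunary_le {n : ℕ} (hn : 1 ≤ n) {χ : E n → ℝ} (hχ : IsCutoff χ)
    (u : 𝓢(E n, ℂ)) {p : ℝ} (hp : 2 < p) : ∃ B : ℝ≥0∞, B < ⊤ ∧
      ∀ a : ℕ → ℂ, (∀ k, ‖a k‖ ≤ coef k) → sobolevNorm χ p ((n : ℝ) / p) (lacunary a u) ≤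
        eLpNorm (lacunary a u) (ENNReal.ofReal p) volume + B := by
  obtain ⟨C, hC, hc⟩ := exists_lpProj_lacunary_decay hn hχ u
  have hp0 : 0 < p := by linarith
  have hn0 : (0 : ℝ) < n := by exact_mod_cast hn
  have hs0 : 0 < (n : ℝ) / p := by positivity
  have hs : 2 * ((n : ℝ) / p) ≤ n := by
    rw [mul_div_assoc', div_le_iff₀ hp0]
    nlinarith
  refine ⟨(∫⁻ ξ : E n, sqMajorant n p ((n : ℝ) / p) (C ^ 2) ξ) ^ (1 / p),
    ENNReal.rpow_lt_top_of_nonneg (by positivity)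
      (lintegral_sqMajorant_lt_top hp (by field_simp) (by positivity)).ne, fun a ha => ?_⟩
  rw [sobolevNorm]
  gcongr
  rw [eLpNorm_eq_lintegral_rpow_enorm_toReal (by simpa using hp0) ENNReal.ofReal_ne_top,
    ENNReal.toReal_ofReal hp0.le]
  gcongr 1
  refine lintegral_mono_ae ?_
  have : Nonempty (Fin n) := ⟨⟨0, hn⟩⟩
  -- The origin belongs to no dyadic shell, but it is a null set in positive dimension.
  have hne : ∀ᵐ ξ : E n, ξ ≠ 0 := by simp [ae_iff]
  filter_upwards [hne] with ξ hξ
  rw [enorm_eq_self, ← ENNReal.rpow_mul, one_div_mul_eq_div]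
  refine le_trans ?_ (ofReal_mul_tsum_sqTerm_le hp0 hs0 hs (sq_nonneg C) hξ)
  gcongr
  exact sqFun_le (fun l => hc a ha l ξ)

/-! ### The lacunary symbol and its regularity. -/

lemma exists_schwartz_bump {n : ℕ} (c : E n) {r R : ℝ} (hr : 0 < r) (hrR : r < R) :
    ∃ ψ : 𝓢(E n, ℂ), (∀ y, R ≤ ‖y - c‖ → ψ y = 0) ∧ (∀ y, ‖y - c‖ ≤ r → ψ y = 1) ∧
      ∀ y, ‖ψ y‖ ≤ 1 := by
  let b : ContDiffBump c := ⟨r, R, hr, hrR⟩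
  have hs : HasCompactSupport fun y => (b y : ℂ) := by
    refine HasCompactSupport.intro (isCompact_closedBall c R) fun y hy => ?_
    rw [b.zero_of_le_dist (not_le.1 hy).le, Complex.ofReal_zero]
  have hcd : ContDiff ℝ ∞ fun y => (b y : ℂ) := by
    have hb : ContDiff ℝ ∞ fun y => b y := b.contDiff
    exact Complex.ofRealCLM.contDiff.comp hb
  refine ⟨hs.toSchwartzMap hcd, fun y hy => ?_, fun y hy => ?_, fun y => ?_⟩
  · change (b y : ℂ) = 0
    rw [b.zero_of_le_dist (by rwa [dist_eq_norm]), Complex.ofReal_zero]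
  · change (b y : ℂ) = 1
    rw [b.one_of_mem_closedBall (by rwa [Metric.mem_closedBall, dist_eq_norm]), Complex.ofReal_one]
  · change ‖(b y : ℂ)‖ ≤ 1
    rw [Complex.norm_real, Real.norm_of_nonneg b.nonneg]
    exact b.le_one

/-- Schwartz functions supported in a small ball around a unit vector. -/
structure IsProfile {n : ℕ} (e : E n) (ψ : 𝓢(E n, ℂ)) : Prop where
  norm_center : ‖e‖ = 1
  eq_zero : ∀ y, 1 / 4 ≤ ‖y - e‖ → ψ y = 0
  eq_one : ∀ y, ‖y - e‖ ≤ 1 / 8 → ψ y = 1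
  norm_le_one : ∀ y, ‖ψ y‖ ≤ 1

lemma norm_two_zpow_smul {n : ℕ} (k : ℕ) (y : E n) :
    ‖((2 : ℝ) ^ (k : ℤ)) • y‖ = (2 : ℝ) ^ k * ‖y‖ := by
  rw [norm_smul, zpow_natCast, Real.norm_of_nonneg (by positivity)]

lemma IsProfile.norm_bounds {n : ℕ} {e : E n} {ψ : 𝓢(E n, ℂ)} (h : IsProfile e ψ) {y : E n}
    (hy : ψ y ≠ 0) : 3 / 4 < ‖y‖ ∧ ‖y‖ < 5 / 4 := by
  have h1 : ‖y - e‖ < 1 / 4 := by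
    by_contra h2
    exact hy (h.eq_zero y (not_lt.1 h2))
  have h2 : ‖y‖ ≤ ‖y - e‖ + ‖e‖ := by simpa using norm_add_le (y - e) e
  have h3 : ‖e‖ ≤ ‖y‖ + ‖y - e‖ := by simpa using norm_sub_le y (y - e)
  rw [h.norm_center] at h2 h3
  constructor <;> linarith

lemma IsProfile.dil_bounds {n : ℕ} {e : E n} {ψ : 𝓢(E n, ℂ)} (h : IsProfile e ψ) {k : ℕ}
    {y : E n} (hy : dil k ψ y ≠ 0) : 3 / 4 < 2 ^ k * ‖y‖ ∧ 2 ^ k * ‖y‖ < 5 / 4 := by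
  rw [← norm_two_zpow_smul]
  exact h.norm_bounds hy

lemma two_pow_lt_of_lt {j k : ℕ} (hjk : j < k) {r : ℝ} (hr : 0 ≤ r) :
    2 * (2 ^ j * r) ≤ 2 ^ k * r := by
  have : (2 : ℝ) ^ (j + 1) ≤ 2 ^ k := pow_le_pow_right₀ one_le_two hjk
  rw [pow_succ] at this
  nlinarith

/-- The profile lives in `3/4 < |y| < 5/4`. The ratio of these radii is below `2`, so distinct
dyadic dilates never meet. -/
lemma IsProfile.dil_eq_zero {n : ℕ} {e : E n} {ψ : 𝓢(E n, ℂ)} (h : IsProfile e ψ) {j k : ℕ}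
    (hjk : j ≠ k) {y : E n} (hk : dil k ψ y ≠ 0) : dil j ψ y = 0 := by
  by_contra hj
  obtain ⟨h1, h2⟩ := h.dil_bounds hk
  obtain ⟨h3, h4⟩ := h.dil_bounds hj
  rcases lt_or_gt_of_ne hjk with hlt | hlt
  · linarith [two_pow_lt_of_lt hlt (norm_nonneg y)]
  · linarith [two_pow_lt_of_lt hlt (norm_nonneg y)]

lemma lacunary_eq_of_forall_ne {n : ℕ} (a : ℕ → ℂ) {ψ : 𝓢(E n, ℂ)} {k : ℕ} {y : E n}
    (h : ∀ j ≠ k, dil j ψ y = 0) : lacunary a ψ y = a k * dil k ψ y :=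
  tsum_eq_single k fun j hj => by rw [h j hj, mul_zero]

lemma IsProfile.exists_single {n : ℕ} {e : E n} {ψ : 𝓢(E n, ℂ)} (h : IsProfile e ψ) (y : E n) :
    ∃ k : ℕ, ∀ j ≠ k, dil j ψ y = 0 := by
  by_cases hy : ∃ k : ℕ, dil k ψ y ≠ 0
  · obtain ⟨k, hk⟩ := hy
    exact ⟨k, fun j hj => h.dil_eq_zero hj hk⟩
  · push Not at hy
    exact ⟨0, fun j _ => hy j⟩

lemma IsProfile.exists_single_nhds {n : ℕ} {e : E n} {ψ : 𝓢(E n, ℂ)} (h : IsProfile e ψ)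
    {ξ : E n} (hξ : ξ ≠ 0) : ∃ k : ℕ, ∀ᶠ y in 𝓝 ξ, ∀ j ≠ k, dil j ψ y = 0 := by
  have hpos := norm_pos_iff.2 hξ
  -- The threshold `5/8` lies below `3/4` and is half of `5/4`. For the least such `k`, nearby
  -- points have `2^j |y| < 3/4` when `j < k` and `2^j |y| > 5/4` when `j > k`.
  have hex : ∃ k : ℕ, 5 / 8 < 2 ^ k * ‖ξ‖ := by
    obtain ⟨k, hk⟩ := pow_unbounded_of_one_lt ((5 / 8) / ‖ξ‖) (one_lt_two (α := ℝ))
    exact ⟨k, by rwa [div_lt_iff₀ hpos] at hk⟩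
  classical
  set k := Nat.find hex with hk
  have hk1 : 5 / 8 < 2 ^ k * ‖ξ‖ := Nat.find_spec hex
  have hk2 : ∀ j < k, 2 ^ j * ‖ξ‖ ≤ 5 / 8 := fun j hj => not_lt.1 (Nat.find_min hex hj)
  have hc (j : ℕ) : Continuous fun y : E n => 2 ^ j * ‖y‖ := by fun_prop
  have ev1 := (hc k).continuousAt.eventually (lt_mem_nhds hk1)
  have ev2 : ∀ᶠ y : E n in 𝓝 ξ, ∀ j < k, 2 ^ j * ‖y‖ < 3 / 4 := by
    refine (Set.finite_lt_nat k).eventually_all.2 fun j hj => ?_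
    exact (hc j).continuousAt.eventually (gt_mem_nhds ((hk2 j hj).trans_lt (by norm_num)))
  refine ⟨k, ?_⟩
  filter_upwards [ev1, ev2] with y hy1 hy2 j hj
  by_contra hne
  obtain ⟨h3, h4⟩ := h.dil_bounds hne
  rcases lt_or_gt_of_ne hj with hlt | hlt
  · linarith [hy2 j hlt]
  · linarith [two_pow_lt_of_lt hlt (norm_nonneg y)]

lemma IsProfile.norm_lacunary_le {n : ℕ} {e : E n} {ψ : 𝓢(E n, ℂ)} (h : IsProfile e ψ) {a : ℕ → ℂ}
    (ha : ∀ k, ‖a k‖ ≤ 1) (y : E n) :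
    ‖lacunary a ψ y‖ ≤ (Metric.closedBall (0 : E n) 2).indicator (fun _ => (1 : ℝ)) y := by
  obtain ⟨k, hk⟩ := h.exists_single y
  rw [lacunary_eq_of_forall_ne a hk]
  by_cases h0 : dil k ψ y = 0
  · rw [h0, mul_zero, norm_zero]
    exact Set.indicator_nonneg (fun _ _ => zero_le_one) _
  · have h1 := (h.dil_bounds h0).2
    have h2 : ‖y‖ ≤ 2 ^ k * ‖y‖ :=
      le_mul_of_one_le_left (norm_nonneg y) (one_le_pow₀ one_le_two)
    rw [Set.indicator_of_mem (by rw [mem_closedBall_zero_iff]; linarith), norm_mul]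
    exact mul_le_one₀ (ha k) (norm_nonneg _) (h.norm_le_one _)

lemma IsProfile.tendsto_lacunary {n : ℕ} {e : E n} {ψ : 𝓢(E n, ℂ)} (h : IsProfile e ψ)
    (a : ℕ → ℂ) (y : E n) :
    Tendsto (fun N => ∑ k ∈ Finset.range N, a k * dil k ψ y) atTop (𝓝 (lacunary a ψ y)) := by
  obtain ⟨k, hk⟩ := h.exists_single y
  rw [lacunary_eq_of_forall_ne a hk]
  exact (hasSum_single k fun j hj => by rw [hk j hj, mul_zero]).tendsto_sum_nat

/-- The modulated coefficients of the counterexample. -/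
def phaseCoef {n : ℕ} (e x : E n) (k : ℕ) : ℂ :=
  coef k * Complex.exp (-(2 * (Real.pi : ℂ) * Complex.I *
    ((inner ℝ (((2 : ℝ) ^ k)⁻¹ • e) x : ℝ) : ℂ)))

lemma norm_phaseCoef {n : ℕ} (e x : E n) (k : ℕ) : ‖phaseCoef e x k‖ = coef k := by
  rw [phaseCoef, norm_mul, Complex.norm_exp, Complex.norm_real,
    Real.norm_of_nonneg (coef_pos k).le]
  simp

/-- The symbol `∑ₖ (k+1)^{-1/2} e^{-2πi 2^{-k} e·x} ψ(2ᵏ ξ)`. -/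
def lacunarySymbol {n : ℕ} (e : E n) (ψ : 𝓢(E n, ℂ)) (x ξ : E n) : ℂ :=
  lacunary (phaseCoef e x) ψ ξ

lemma norm_phaseCoef_le_one {n : ℕ} (e x : E n) (k : ℕ) : ‖phaseCoef e x k‖ ≤ 1 :=
  (norm_phaseCoef e x k).trans_le (coef_le_one k)

lemma IsProfile.integrable_lacunarySymbol {n : ℕ} {e : E n} {ψ : 𝓢(E n, ℂ)} (h : IsProfile e ψ)
    (x : E n) : Integrable (lacunarySymbol e ψ x) := by
  have hm : AEStronglyMeasurable (lacunarySymbol e ψ x) volume := by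
    refine aestronglyMeasurable_of_tendsto_ae atTop
      (f := fun N y => ∑ k ∈ Finset.range N, phaseCoef e x k * dil k ψ y) (fun N => ?_)
      (ae_of_all _ (h.tendsto_lacunary _))
    have hc (k : ℕ) : Continuous (dil k ψ) := (dil k ψ).continuous
    exact Continuous.aestronglyMeasurable (by fun_prop)
  refine Integrable.mono' (g := (Metric.closedBall (0 : E n) 2).indicator fun _ => (1 : ℝ)) ?_ hm
    (ae_of_all _ (h.norm_lacunary_le (norm_phaseCoef_le_one e x)))
  exact (integrable_indicator_iff measurableSet_closedBall).2
    (integrableOn_const measure_closedBall_lt_top.ne)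

lemma tendsto_average_ball_of_integrable {n : ℕ} (hn : 1 ≤ n) {g : E n → ℂ} (hg : Integrable g) :
    Tendsto (fun R : ℝ => ⨍ ξ in Metric.ball (0 : E n) R, ‖g ξ‖) atTop (𝓝 0) := by
  set V := (volume : Measure (E n)).real (Metric.ball 0 1) with hV
  have hVpos : 0 < V := volume_real_unit_ball_pos
  have hlim : Tendsto (fun R : ℝ => (R ^ n * V)⁻¹ * ∫ ξ, ‖g ξ‖) atTop (𝓝 0) := by
    rw [← zero_mul (∫ ξ, ‖g ξ‖)]
    refine Tendsto.mul_const _ (tendsto_inv_atTop_zero.comp ?_)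
    exact (tendsto_pow_atTop (by omega)).atTop_mul_const hVpos
  refine tendsto_of_tendsto_of_tendsto_of_le_of_le' tendsto_const_nhds hlim ?_ ?_
  · refine Eventually.of_forall fun R => ?_
    rw [setAverage_eq, smul_eq_mul]
    exact mul_nonneg (inv_nonneg.2 measureReal_nonneg) (integral_nonneg fun _ => norm_nonneg _)
  · filter_upwards [eventually_gt_atTop 0] with R hR
    rw [setAverage_eq, smul_eq_mul, volume_real_ball hR, ← hV]
    refine mul_le_mul_of_nonneg_left ?_ (by positivity)
    exact setIntegral_le_integral hg.norm (ae_of_all _ fun _ => norm_nonneg _)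

lemma IsProfile.isSymbol {n : ℕ} (hn : 1 ≤ n) {e : E n} {ψ : 𝓢(E n, ℂ)} (h : IsProfile e ψ) :
    IsSymbol (lacunarySymbol e ψ) where
  measurable := by
    refine aestronglyMeasurable_of_tendsto_ae atTop (f := fun N (z : E n × E n) =>
      ∑ k ∈ Finset.range N, phaseCoef e z.1 k * dil k ψ z.2) (fun N => ?_)
      (ae_of_all _ fun z => h.tendsto_lacunary _ _)
    have hc (k : ℕ) : Continuous (dil k ψ) := (dil k ψ).continuous
    unfold phaseCoef
    exact Continuous.aestronglyMeasurable (by fun_prop)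
  locallyIntegrable x := (h.integrable_lacunarySymbol x).locallyIntegrable
  mean_tendsto_zero x := tendsto_average_ball_of_integrable hn (h.integrable_lacunarySymbol x)

/-- Near each `ξ ≠ 0` the symbol is one dilate times a constant of modulus at most `1`. The quantity
`|ξ|^i |D^i|` is invariant under dilation, so a seminorm of `ψ` bounds it for all `k` at once. -/
lemma IsProfile.mihlinBounds {n : ℕ} {e : E n} {ψ : 𝓢(E n, ℂ)} (h : IsProfile e ψ) :
    MihlinBounds (lacunarySymbol e ψ) := by
  have hloc {ξ : E n} (hξ : ξ ≠ 0) (x : E n) : ∃ k : ℕ, lacunarySymbol e ψ x =ᶠ[𝓝 ξ]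
      fun y => phaseCoef e x k • dil k ψ y := by
    obtain ⟨k, hk⟩ := h.exists_single_nhds hξ
    exact ⟨k, hk.mono fun y hy => lacunary_eq_of_forall_ne _ hy⟩
  refine ⟨fun x ξ hξ => ?_, fun i => ⟨SchwartzMap.seminorm ℝ i i ψ, fun x ξ hξ => ?_⟩⟩
  · obtain ⟨k, hk⟩ := hloc hξ x
    have : ContDiffAt ℝ ∞ (fun y => phaseCoef e x k • dil k ψ y) ξ :=
      ((dil k ψ).smooth ⊤).contDiffAt.const_smul _
    exact (this.congr_of_eventuallyEq hk).contDiffWithinAt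
  · obtain ⟨k, hk⟩ := hloc hξ x
    have hpos := norm_pos_iff.2 hξ
    rw [(hk.iteratedFDeriv ℝ i).eq_of_nhds,
      iteratedFDeriv_const_smul_apply' ((dil k ψ).smooth i).contDiffAt, norm_smul,
      norm_iteratedFDeriv_dil, le_div_iff₀ (by positivity), zpow_natCast]
    have h1 := ψ.le_seminorm ℝ i i (((2 : ℝ) ^ (k : ℤ)) • ξ)
    rw [norm_two_zpow_smul, zpow_natCast] at h1
    calc _ ≤ 1 * ((2 ^ k) ^ i * ‖iteratedFDeriv ℝ i ψ ((2 : ℝ) ^ k • ξ)‖) * ‖ξ‖ ^ i := by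
          gcongr
          exact norm_phaseCoef_le_one e x k
      _ = (2 ^ k * ‖ξ‖) ^ i * ‖iteratedFDeriv ℝ i ψ ((2 : ℝ) ^ k • ξ)‖ := by
          rw [mul_pow]; ring
      _ ≤ _ := h1

lemma IsProfile.iSup_sobolevNorm_lt_top {n : ℕ} (hn : 1 ≤ n) {χ : E n → ℝ} (hχ : IsCutoff χ)
    {e : E n} {ψ : 𝓢(E n, ℂ)} (h : IsProfile e ψ) {p : ℝ} (hp : 2 < p) :
    ⨆ x, sobolevNorm χ p ((n : ℝ) / p) (lacunarySymbol e ψ x) < ⊤ := by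
  obtain ⟨B, hB, hb⟩ := exists_sobolevNorm_lacunary_le hn hχ ψ hp
  set A := eLpNorm ((Metric.closedBall (0 : E n) 2).indicator fun _ => (1 : ℝ))
    (ENNReal.ofReal p) volume
  have hA : A < ⊤ := (memLp_indicator_const _ measurableSet_closedBall (1 : ℝ)
    (Or.inr measure_closedBall_lt_top.ne)).eLpNorm_lt_top
  refine lt_of_le_of_lt (iSup_le fun x => ?_) (ENNReal.add_lt_top.2 ⟨hA, hB⟩)
  refine (hb _ fun k => (norm_phaseCoef e x k).le).trans ?_
  gcongr
  exact eLpNorm_mono_real (h.norm_lacunary_le (norm_phaseCoef_le_one e x))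

/-! ### Test functions and unboundedness on `L²`. -/

/-- The frequencies `2^{-k} e`. -/
def freq {n : ℕ} (e : E n) (k : ℕ) : E n := ((2 : ℝ) ^ k)⁻¹ • e

/-- The superposition of translates of `G` to the frequencies `2^{-k} e`, `k < N`. -/
def lacunaryTest {n : ℕ} (e : E n) (G : 𝓢(E n, ℂ)) (N : ℕ) : 𝓢(E n, ℂ) :=
  ∑ k ∈ Finset.range N, (coef k : ℂ) • transl (-freq e k) G

lemma lacunaryTest_apply {n : ℕ} (e : E n) (G : 𝓢(E n, ℂ)) (N : ℕ) (ξ : E n) :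
    lacunaryTest e G N ξ = ∑ k ∈ Finset.range N, (coef k : ℂ) * G (ξ - freq e k) := by
  simp [lacunaryTest, sub_eq_add_neg]

lemma integral_exp_mul_sub {n : ℕ} (G : E n → ℂ) (v x : E n) :
    ∫ ξ, Complex.exp (2 * (Real.pi : ℂ) * Complex.I * ((inner ℝ ξ x : ℝ) : ℂ)) * G (ξ - v) =
      Complex.exp (2 * (Real.pi : ℂ) * Complex.I * ((inner ℝ v x : ℝ) : ℂ)) * 𝓕⁻ G x := by
  rw [← integral_add_right_eq_self _ v, Real.fourierInv_eq', ← integral_const_mul]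
  refine integral_congr_ae (ae_of_all _ fun ξ => ?_)
  simp only [add_sub_cancel_right, smul_eq_mul, ← mul_assoc, ← Complex.exp_add, inner_add_left]
  congr 2
  push_cast
  ring

/-- For `k < N` a ball of radius `2^{-N}/8` about `2^{-k} e` is mapped by the dilation `2^k` into
the plateau of `ψ` around `e`. -/
lemma IsProfile.dil_eq_one {n : ℕ} {e : E n} {ψ : 𝓢(E n, ℂ)} (h : IsProfile e ψ) {k N : ℕ}
    (hk : k < N) {ξ : E n} (hξ : 2 ^ N * ‖ξ - freq e k‖ < 1 / 8) : dil k ψ ξ = 1 := by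
  rw [dil_apply]
  refine h.eq_one _ ?_
  have h1 : ((2 : ℝ) ^ (k : ℤ)) • ξ - e = ((2 : ℝ) ^ (k : ℤ)) • (ξ - freq e k) := by
    rw [smul_sub, freq, smul_smul, zpow_natCast, mul_inv_cancel₀ (by positivity), one_smul]
  rw [h1, norm_two_zpow_smul]
  linarith [two_pow_lt_of_lt hk (norm_nonneg (ξ - freq e k)), norm_nonneg (ξ - freq e k),
    mul_nonneg (pow_nonneg two_pos.le k) (norm_nonneg (ξ - freq e k))]

lemma IsProfile.lacunarySymbol_mul {n : ℕ} {e : E n} {ψ G : 𝓢(E n, ℂ)} (h : IsProfile e ψ) {N k : ℕ}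
    (hk : k < N) (hG : ∀ y, G y ≠ 0 → 2 ^ N * ‖y‖ < 1 / 8) (x ξ : E n) :
    lacunarySymbol e ψ x ξ * G (ξ - freq e k) = phaseCoef e x k * G (ξ - freq e k) := by
  by_cases h0 : G (ξ - freq e k) = 0
  · rw [h0, mul_zero, mul_zero]
  · have h1 := h.dil_eq_one hk (hG _ h0)
    rw [lacunarySymbol, lacunary_eq_of_forall_ne (k := k), h1, mul_one]
    exact fun j hj => h.dil_eq_zero hj (by rw [h1]; exact one_ne_zero)

lemma phaseCoef_mul_exp {n : ℕ} (e x : E n) (k : ℕ) :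
    phaseCoef e x k *
      Complex.exp (2 * (Real.pi : ℂ) * Complex.I * ((inner ℝ (freq e k) x : ℝ) : ℂ)) =
        coef k := by
  rw [phaseCoef, freq, mul_assoc, ← Complex.exp_add, neg_add_cancel, Complex.exp_zero, mul_one]

/-- On the piece of `f̂` at `2^{-k} e` the symbol is the constant `phaseCoef e x k`, whose phase
cancels the modulation `e^{2πi 2^{-k} e·x}` of that piece. Every `k` thus contributes `coef k ^ 2`
times the same function. -/
lemma IsProfile.pdo_lacunaryTest {n : ℕ} {e : E n} {ψ G : 𝓢(E n, ℂ)} (h : IsProfile e ψ) {N : ℕ}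
    (hG : ∀ y, G y ≠ 0 → 2 ^ N * ‖y‖ < 1 / 8) (x : E n) :
    pdo (lacunarySymbol e ψ) (𝓕⁻ (lacunaryTest e G N) : 𝓢(E n, ℂ)) x =
      ((∑ k ∈ Finset.range N, coef k ^ 2 : ℝ) : ℂ) * (𝓕⁻ G : 𝓢(E n, ℂ)) x := by
  have hF (ξ : E n) : 𝓕 ((𝓕⁻ (lacunaryTest e G N) : 𝓢(E n, ℂ)) : E n → ℂ) ξ =
      lacunaryTest e G N ξ := by
    rw [← SchwartzMap.fourier_coe, FourierTransform.fourier_fourierInv_eq]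
  have hint (k : ℕ) : Integrable fun ξ : E n => coef k * phaseCoef e x k *
      (Complex.exp (2 * (Real.pi : ℂ) * Complex.I * ((inner ℝ ξ x : ℝ) : ℂ)) *
        G (ξ - freq e k)) := by
    refine Integrable.const_mul ?_ _
    have hGc := G.continuous
    refine (G.integrable.comp_sub_right (freq e k)).norm.mono'
      (Continuous.aestronglyMeasurable (by fun_prop)) (ae_of_all _ fun ξ => ?_)
    rw [norm_mul, Complex.norm_exp]
    simp
  calc _ = ∫ ξ, ∑ k ∈ Finset.range N, coef k * phaseCoef e x k *
        (Complex.exp (2 * (Real.pi : ℂ) * Complex.I * ((inner ℝ ξ x : ℝ) : ℂ)) *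
          G (ξ - freq e k)) := by
        refine integral_congr_ae (ae_of_all _ fun ξ => ?_)
        simp only [hF, lacunaryTest_apply, Finset.mul_sum]
        refine Finset.sum_congr rfl fun k hk => ?_
        linear_combination (Complex.exp (2 * (Real.pi : ℂ) * Complex.I *
          ((inner ℝ ξ x : ℝ) : ℂ)) * coef k) * h.lacunarySymbol_mul (Finset.mem_range.1 hk) hG x ξ
    _ = ∑ k ∈ Finset.range N, (coef k : ℂ) ^ 2 * (𝓕⁻ G : 𝓢(E n, ℂ)) x := by
        rw [integral_finsetSum _ fun k _ => hint k]
        refine Finset.sum_congr rfl fun k _ => ?_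
        rw [integral_const_mul, integral_exp_mul_sub, SchwartzMap.fourierInv_coe]
        linear_combination (coef k : ℂ) * 𝓕⁻ (G : E n → ℂ) x * phaseCoef_mul_exp e x k
    _ = _ := by
        rw [← Finset.sum_mul]
        push_cast
        rfl

lemma eLpNorm_fourierInv {n : ℕ} (u : 𝓢(E n, ℂ)) :
    eLpNorm (𝓕⁻ u : 𝓢(E n, ℂ)) 2 volume = eLpNorm u 2 volume := by
  rw [← eLpNorm_fourier, FourierTransform.fourier_fourierInv_eq]

/-- The translates of `G` sit in the plateaus of different dilates of `ψ`, hence are disjoint, and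
the square of the sum has no cross terms. -/
lemma IsProfile.lintegral_lacunaryTest {n : ℕ} {e : E n} {ψ G : 𝓢(E n, ℂ)} (h : IsProfile e ψ)
    {N : ℕ} (hG : ∀ y, G y ≠ 0 → 2 ^ N * ‖y‖ < 1 / 8) :
    ∫⁻ ξ, ‖lacunaryTest e G N ξ‖ₑ ^ 2 =
      ENNReal.ofReal (∑ k ∈ Finset.range N, coef k ^ 2) * ∫⁻ ξ, ‖G ξ‖ₑ ^ 2 := by
  have hGc := G.continuous
  have hpt (ξ : E n) : ‖lacunaryTest e G N ξ‖ₑ ^ 2 =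
      ∑ k ∈ Finset.range N, ENNReal.ofReal (coef k ^ 2) * ‖G (ξ - freq e k)‖ₑ ^ 2 := by
    rw [lacunaryTest_apply]
    by_cases hex : ∃ k ∈ Finset.range N, G (ξ - freq e k) ≠ 0
    · obtain ⟨k, hk, hk0⟩ := hex
      have hz : ∀ j ∈ Finset.range N, j ≠ k → G (ξ - freq e j) = 0 := by
        intro j hj hjk
        by_contra hj0
        have h1 := h.dil_eq_one (Finset.mem_range.1 hk) (hG _ hk0)
        have h2 := h.dil_eq_one (Finset.mem_range.1 hj) (hG _ hj0)
        have h3 := h.dil_eq_zero hjk (by rw [h1]; exact one_ne_zero)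
        exact one_ne_zero (h2.symm.trans h3)
      rw [Finset.sum_eq_single k (fun j hj hjk => by rw [hz j hj hjk, mul_zero])
        (fun hk' => absurd hk hk'), Finset.sum_eq_single k
        (fun j hj hjk => by rw [hz j hj hjk]; simp) (fun hk' => absurd hk hk'), enorm_mul, mul_pow,
        ← ofReal_norm, Complex.norm_real, Real.norm_of_nonneg (coef_pos k).le,
        ENNReal.ofReal_pow (coef_pos k).le]
    · push Not at hex
      rw [Finset.sum_eq_zero fun k hk => by rw [hex k hk, mul_zero],
        Finset.sum_eq_zero fun k hk => by rw [hex k hk]; simp]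
      simp
  have hm (k : ℕ) : Measurable fun ξ => ‖G (ξ - freq e k)‖ₑ ^ 2 :=
    Continuous.measurable (by fun_prop)
  simp only [hpt]
  rw [lintegral_finsetSum _ fun k _ => (hm k).const_mul _,
    ENNReal.ofReal_sum_of_nonneg fun k _ => sq_nonneg _, Finset.sum_mul]
  refine Finset.sum_congr rfl fun k _ => ?_
  rw [lintegral_const_mul _ (hm k)]
  congr 1
  exact lintegral_sub_right_eq_self (fun ξ => ‖G ξ‖ₑ ^ 2) (freq e k)

lemma exists_concentrated (n N : ℕ) : ∃ G : 𝓢(E n, ℂ), (∀ y, G y ≠ 0 → 2 ^ N * ‖y‖ < 1 / 8) ∧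
    eLpNorm G 2 volume ≠ 0 := by
  obtain ⟨g, hg0, hg1, -⟩ := exists_schwartz_bump (0 : E n) (r := 1 / 16) (R := 1 / 8)
    (by norm_num) (by norm_num)
  refine ⟨dil N g, fun y hy => ?_, fun h => ?_⟩
  · rw [← norm_two_zpow_smul]
    by_contra h
    exact hy (hg0 _ (by simpa using h))
  · have hz : (dil N g : E n → ℂ) =ᵐ[volume] 0 :=
      (eLpNorm_eq_zero_iff (dil N g).continuous.aestronglyMeasurable two_ne_zero).1 h
    have := congrFun ((dil N g).continuous.ae_eq_iff_eq volume continuous_zero |>.1 hz) 0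
    rw [dil_apply, smul_zero, hg1 0 (by simp)] at this
    exact one_ne_zero this

lemma IsProfile.sqrt_le_pdoNorm {n : ℕ} {e : E n} {ψ : 𝓢(E n, ℂ)} (h : IsProfile e ψ) {N : ℕ}
    (hN : 0 < N) :
    ENNReal.ofReal (√(∑ k ∈ Finset.range N, coef k ^ 2)) ≤ pdoNorm (lacunarySymbol e ψ) := by
  obtain ⟨G, hG, hG0⟩ := exists_concentrated n N
  set H := ∑ k ∈ Finset.range N, coef k ^ 2 with hH
  have hHpos : 0 < H := Finset.sum_pos (fun k _ => pow_pos (coef_pos k) 2)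
    ⟨0, Finset.mem_range.2 hN⟩
  have hGt : eLpNorm G 2 volume ≠ ⊤ := (G.eLpNorm_lt_top _ _).ne
  have hf : eLpNorm (𝓕⁻ (lacunaryTest e G N) : 𝓢(E n, ℂ)) 2 volume =
      ENNReal.ofReal (√H) * eLpNorm G 2 volume := by
    rw [eLpNorm_fourierInv, eLpNorm_two, eLpNorm_two, h.lintegral_lacunaryTest hG,
      ENNReal.mul_rpow_of_nonneg _ _ (by norm_num), ENNReal.ofReal_rpow_of_pos hHpos,
      Real.sqrt_eq_rpow]
  have hT : eLpNorm (pdo (lacunarySymbol e ψ) (𝓕⁻ (lacunaryTest e G N) : 𝓢(E n, ℂ))) 2 volume =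
      ENNReal.ofReal H * eLpNorm G 2 volume := by
    have : pdo (lacunarySymbol e ψ) (𝓕⁻ (lacunaryTest e G N) : 𝓢(E n, ℂ)) =
        (H : ℂ) • ⇑(𝓕⁻ G : 𝓢(E n, ℂ)) := funext fun x => h.pdo_lacunaryTest hG x
    rw [this, eLpNorm_const_smul, eLpNorm_fourierInv, ← ofReal_norm, Complex.norm_real,
      Real.norm_of_nonneg hHpos.le]
  refine le_trans ?_ (le_iSup (fun f : 𝓢(E n, ℂ) =>
    eLpNorm (pdo (lacunarySymbol e ψ) f) 2 volume / eLpNorm f 2 volume)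
    (𝓕⁻ (lacunaryTest e G N)))
  have hpos : ENNReal.ofReal (√H) ≠ 0 := by
    simpa using Real.sqrt_pos.2 hHpos
  rw [hf, hT, ENNReal.le_div_iff_mul_le (Or.inl (mul_ne_zero hpos hG0))
    (Or.inl (ENNReal.mul_ne_top ENNReal.ofReal_ne_top hGt)), ← mul_assoc,
    ← ENNReal.ofReal_mul (Real.sqrt_nonneg _), Real.mul_self_sqrt hHpos.le]

lemma tendsto_sum_coef_sq :
    Tendsto (fun N => ∑ k ∈ Finset.range N, coef k ^ 2) atTop atTop := by
  simpa [coef_sq] using Real.tendsto_sum_range_one_div_nat_succ_atTop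

lemma IsProfile.pdoNorm_eq_top {n : ℕ} {e : E n} {ψ : 𝓢(E n, ℂ)} (h : IsProfile e ψ) :
    pdoNorm (lacunarySymbol e ψ) = ⊤ := by
  refine top_unique (le_of_tendsto (ENNReal.tendsto_ofReal_atTop.comp
    (Real.tendsto_sqrt_atTop.comp tendsto_sum_coef_sq)) ?_)
  filter_upwards [eventually_gt_atTop 0] with N hN
  exact h.sqrt_le_pdoNorm hN

lemma exists_isProfile {n : ℕ} (hn : 1 ≤ n) : ∃ (e : E n) (ψ : 𝓢(E n, ℂ)), IsProfile e ψ := by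
  obtain ⟨ψ, h0, h1, h2⟩ := exists_schwartz_bump (EuclideanSpace.single (⟨0, hn⟩ : Fin n) (1 : ℝ))
    (r := 1 / 8) (R := 1 / 4) (by norm_num) (by norm_num)
  exact ⟨_, ψ, by simp, h0, h1, h2⟩

end RoughPDO

end

theorem theorem1 (n : ℕ) (hn : 1 ≤ n) (χ : RoughPDO.E n → ℝ) (hχ : RoughPDO.IsCutoff χ) :
    (∃ C : NNReal, 0 < C ∧ ∀ σ : RoughPDO.E n → RoughPDO.E n → ℂ, RoughPDO.IsSymbol σ →
      RoughPDO.pdoNorm σ ≤ (C : ℝ≥0∞) * RoughPDO.besovSup χ σ ∧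
      (RoughPDO.besovSup χ σ < ⊤ →
        ∃ T : Lp ℂ 2 (volume : Measure (RoughPDO.E n)) →L[ℂ]
            Lp ℂ 2 (volume : Measure (RoughPDO.E n)),
          ∀ f : 𝓢(RoughPDO.E n, ℂ), (T (f.toLp 2) : RoughPDO.E n → ℂ) =ᵐ[volume]
            RoughPDO.pdo σ f)) ∧
    (∀ p : ℝ, 2 < p → ∃ σ : RoughPDO.E n → RoughPDO.E n → ℂ,
      RoughPDO.IsSymbol σ ∧
      RoughPDO.MihlinBounds σ ∧
      (⨆ x : RoughPDO.E n, RoughPDO.sobolevNorm χ p ((n : ℝ) / p) (σ x)) < ⊤ ∧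
      RoughPDO.pdoNorm σ = ⊤) := by
  refine ⟨⟨RoughPDO.besovConst hχ, by rw [RoughPDO.besovConst]; positivity, fun σ hσ =>
    ⟨RoughPDO.pdoNorm_le hχ hσ, RoughPDO.exists_extension hχ hσ⟩⟩, fun p hp => ?_⟩
  obtain ⟨e, ψ, h⟩ := RoughPDO.exists_isProfile hn
  exact ⟨RoughPDO.lacunarySymbol e ψ, h.isSymbol hn, h.mihlinBounds,
    h.iSup_sobolevNorm_lt_top hn hχ hp, h.pdoNorm_eq_top⟩
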